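/- Let $\kappa$ be an algebraically closed field of characteristic zero and let $X$ be a nonsingular (integral) projective variety over $\kappa$ of dimension $n\ge 2$. Let $\mathcal E$ and $\mathcal F$ be vector bundles on $X$ (of ranks $\operatorname{rk}\mathcal E$, $\operatorname{rk}\mathcal F$) such that (1) $\mathcal E$ and $\mathcal F$ are simple, i.e. $\operatorname{Hom}(\mathcal E,\mathcal E)=\operatorname{Hom}(\mathcal F,\mathcal F)=\kappa$; (2) $\operatorname{Hom}(\mathcal F,\mathcal E)=0$; (3) $\operatorname{Ext}^1(\mathcal F,\mathcal E)=0$; (4) $\mathcal E^\vee\otimes\mathcal F$ is globally generated; (5) $w:=\dim_\kappa\operatorname{Hom}(\mathcal E,\mathcal F)\ge 3$. Fix a basis $\sigma=(\sigma_1,\dots,\sigma_w)$ of $\operatorname{Hom}(\mathcal E,\mathcal F)$. A representation $R=(V,W,(A_i)_{i=1}^w)$ of the Kronecker quiver $K_w$ (finite dimensional $\kappa$-vector spaces $V,W$ and linear maps $A_i:V\to W$) is called *globally injective* if the map on fibers $\sum_i A_i\otimes\sigma_i(P):V\otimes\mathcal E_P\to W\otimes\mathcal F_P$ is injective for every (closed)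 point $P\in X$. A *cokernel bundle of type* $(\mathcal E,\mathcal F)$ is a vector bundle $\mathcal C$ on $X$ admitting, for some integers $a,b\ge0$, an exact sequence $$0\to\mathcal E^a\to\mathcal F^b\to\mathcal C\to0 .$$ Globally injective representations and cokernel bundles are regarded as full subcategories of the category of representations of $K_w$ and of the category of coherent sheaves on $X$, respectively. Then: (a) $R\mapsto\operatorname{coker}\bigl(\sum_i A_i\otimes\sigma_i:V\otimes\mathcal E\to W\otimes\mathcal F\bigr)$, with a morphism $(f_1,f_2)$ sent to the map of cokernels induced by $f_1\otimes1_{\mathcal E}$ and $f_2\otimes1_{\mathcal F}$, is an equivalence from the category of globally injective representations of $K_w$ to the category of cokernel bundles of type $(\mathcal E,\mathcal F)$. (b) The same functor is an equivalence from the category of those globally injective representations with $\dim W\cdot\operatorname{rk}\mathcal F-\dim V\cdot\operatorname{rk}\mathcal E\ge n$ to the category of those cokernel bundles of type $(\mathcal E,\mathcal F)$ that have a resolution as above with $b\operatorname{rk}\mathcal F-a\operatorname{rk}\mathcal E\ge n$. -/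

import Mathlib

open CategoryTheory Limits AlgebraicGeometry TopologicalSpace
open scoped TensorProduct

universe u

namespace KroneckerCokernel

noncomputable section

section Scalars

variable {X : Scheme.{u}}

/-- Multiplication by a global function `r` on an `𝒪_X`-module, as an `𝒪_X`-linear map. -/
def globalScalar (r : Γ(X, ⊤)) (M : X.Modules) : M ⟶ M :=
  (⟨PresheafOfModules.homMk
    { app := fun U => AddCommGrpCat.ofHom
        (DistribSMul.toAddMonoidHom Γ(M, U.unop)
          (X.presheaf.map (homOfLE le_top).op r : Γ(X, U.unop)))
      naturality := by
        intro U V i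
        ext m
        have h := M.map_smul i.unop (X.presheaf.map (homOfLE (le_top : U.unop ≤ ⊤)).op r) m
        rw [← CommRingCat.comp_apply, ← Functor.map_comp] at h
        exact h.symm }
    (fun U s m => smul_comm (X.presheaf.map (homOfLE le_top).op r : Γ(X, U.unop))
      (show Γ(X, U.unop) from s) (show Γ(M, U.unop) from m))⟩ : SheafOfModules.Hom M M)

theorem globalScalar_app (r : Γ(X, ⊤)) (M : X.Modules) (U : X.Opens) (m : Γ(M, U)) :
    (globalScalar r M).app U m = (X.presheaf.map (homOfLE le_top).op r : Γ(X, U)) • m := rfl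

theorem catCenter_ext {a b : CatCenter X.Modules}
    (h : ∀ (M : X.Modules) (U : X.Opens) (m : Γ(M, U)),
      (a.app M).app U m = (b.app M).app U m) : a = b := by
  refine CatCenter.ext _ _ fun M => Scheme.Modules.hom_ext _ _ fun U => ?_
  exact AddCommGrpCat.hom_ext (AddMonoidHom.ext fun m => h M U m)

/-- Global functions act on the category of `𝒪_X`-modules. -/
def globalScalarHom : Γ(X, ⊤) →+* CatCenter X.Modules where
  toFun r :=
    { app := fun M => globalScalar r M
      naturality := fun M N φ => by
        apply Scheme.Modules.hom_ext
        intro U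
        ext m
        exact (φ.app_smul _ m).symm }
  map_one' := catCenter_ext fun M U m => by
    change (X.presheaf.map _ (1 : Γ(X, ⊤)) : Γ(X, U)) • m = m
    rw [map_one, one_smul]
  map_mul' r s := catCenter_ext fun M U m => by
    change (X.presheaf.map _ (r * s : Γ(X, ⊤)) : Γ(X, U)) • m =
      (X.presheaf.map _ r : Γ(X, U)) • (X.presheaf.map _ s : Γ(X, U)) • m
    rw [map_mul, mul_smul]
  map_zero' := catCenter_ext fun M U m => by
    change (X.presheaf.map _ (0 : Γ(X, ⊤)) : Γ(X, U)) • m = 0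
    rw [map_zero, zero_smul]
  map_add' r s := catCenter_ext fun M U m => by
    change (X.presheaf.map _ (r + s : Γ(X, ⊤)) : Γ(X, U)) • m =
      (X.presheaf.map _ r : Γ(X, U)) • m + (X.presheaf.map _ s : Γ(X, U)) • m
    rw [map_add, add_smul]

/-- The ring map `κ → Γ(X, 𝒪_X)` given by the structure morphism of the `κ`-scheme `X`. -/
def scalarSection (κ : Type u) [Field κ] (X : Scheme.{u}) [X.Over (Spec (.of κ))] :
    κ →+* Γ(X, ⊤) :=
  ((X ↘ Spec (.of κ)).appTop.hom).comp (Scheme.ΓSpecIso (.of κ)).inv.hom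

/-- For a `κ`-scheme `X`, the `Hom`-groups of `𝒪_X`-modules are `κ`-vector spaces and composition
is bilinear. -/
instance modulesLinear (κ : Type u) [Field κ] (X : Scheme.{u}) [X.Over (Spec (.of κ))] :
    Linear κ X.Modules :=
  Linear.ofRingMorphism (globalScalarHom.comp (scalarSection κ X))

end Scalars

section Projective

variable (κ : Type u) [Field κ]

attribute [local instance] MvPolynomial.gradedAlgebra

/-- Projective space `ℙ^N` over `κ`, as `Proj κ[x₀, …, x_N]`. -/
def projectiveSpace (N : ℕ) : Scheme.{u} :=
  Proj (MvPolynomial.homogeneousSubmodule (Fin (N + 1)) κ)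

/-- The structure morphism `ℙ^N → Spec κ[x₀, …, x_N]₀ → Spec κ`. -/
instance projectiveSpaceOver (N : ℕ) : (projectiveSpace κ N).Over (Spec (.of κ)) where
  hom := Proj.toSpecZero (MvPolynomial.homogeneousSubmodule (Fin (N + 1)) κ) ≫
    Spec.map (CommRingCat.ofHom
      (algebraMap κ (MvPolynomial.homogeneousSubmodule (Fin (N + 1)) κ 0)))

/-- `X` is a projective `κ`-scheme: it has a closed immersion over `κ` into some `ℙ^N`. -/
def IsProjective (X : Scheme.{u}) [X.Over (Spec (.of κ))] : Prop :=
  ∃ (N : ℕ) (i : X ⟶ projectiveSpace κ N), IsClosedImmersion i ∧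
    i ≫ (projectiveSpace κ N ↘ Spec (.of κ)) = X ↘ Spec (.of κ)

end Projective

section Fibers

variable {X : Scheme.{u}}

/-- The presheaf of modules underlying an `𝒪_X`-module, over the presheaf of commutative rings
`𝒪_X`. -/
def commPresheaf (M : X.Modules) :
    _root_.PresheafOfModules.{u} (X.presheaf ⋙ forget₂ CommRingCat RingCat) :=
  M.val

/-- The stalk `M_x` as a module over the local ring `𝒪_{X,x}`. -/
instance stalkModule (x : X) (M : X.Modules) : Module (X.presheaf.stalk x) (M.presheaf.stalk x) :=
  inferInstanceAs (Module (X.presheaf.stalk x)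
    (TopCat.Presheaf.stalk (C := Ab.{u}) (commPresheaf M).presheaf x))

theorem germ_smul (M : X.Modules) (x : X) (U : X.Opens) (hx : x ∈ U) (r : Γ(X, U))
    (m : Γ(M, U)) :
    M.presheaf.germ U x hx (r • m) = X.presheaf.germ U x hx r • M.presheaf.germ U x hx m :=
  PresheafOfModules.germ_smul (R := X.presheaf) (commPresheaf M) x U hx r m

/-- The `𝒪_{X,x}`-linear map induced on stalks at `x` by a morphism of `𝒪_X`-modules. -/
def stalkMap {M N : X.Modules} (φ : M ⟶ N) (x : X) :
    M.presheaf.stalk x →ₗ[X.presheaf.stalk x] N.presheaf.stalk x where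
  toFun := (TopCat.Presheaf.stalkFunctor Ab x).map φ.mapPresheaf
  map_add' := map_add _
  map_smul' r m := by
    obtain ⟨U, hU, r, rfl⟩ := TopCat.Presheaf.exists_germ_eq _ r
    obtain ⟨V, hV, m, rfl⟩ := TopCat.Presheaf.exists_germ_eq _ m
    have hW : x ∈ U ⊓ V := ⟨hU, hV⟩
    rw [← TopCat.Presheaf.germ_res_apply _ (homOfLE (inf_le_left : U ⊓ V ≤ U)) x hW r,
      ← TopCat.Presheaf.germ_res_apply _ (homOfLE (inf_le_right : U ⊓ V ≤ V)) x hW m,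
      ← germ_smul]
    simp only [TopCat.Presheaf.stalkFunctor_map_germ_apply, RingHom.id_apply,
      Scheme.Modules.mapPresheaf_app, ← germ_smul]
    exact congrArg _ (φ.app_smul _ _)

/-- The fiber `κ(x) ⊗ M_x` of `M` at `x`, the tensor product being over `𝒪_{X,x}`. -/
def Fiber (M : X.Modules) (x : X) : Type u :=
  IsLocalRing.ResidueField (X.presheaf.stalk x) ⊗[X.presheaf.stalk x] M.presheaf.stalk x

instance fiberAddCommGroup (M : X.Modules) (x : X) : AddCommGroup (Fiber M x) :=
  inferInstanceAs (AddCommGroup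
    (IsLocalRing.ResidueField (X.presheaf.stalk x) ⊗[X.presheaf.stalk x] M.presheaf.stalk x))

instance fiberModule (M : X.Modules) (x : X) :
    Module (IsLocalRing.ResidueField (X.presheaf.stalk x)) (Fiber M x) :=
  inferInstanceAs (Module (IsLocalRing.ResidueField (X.presheaf.stalk x))
    (IsLocalRing.ResidueField (X.presheaf.stalk x) ⊗[X.presheaf.stalk x] M.presheaf.stalk x))

variable (κ : Type u) [Field κ] [X.Over (Spec (.of κ))]

/-- The structure map `κ → κ(x)`. -/
def scalarResidue (x : X) : κ →+* IsLocalRing.ResidueField (X.presheaf.stalk x) :=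
  (IsLocalRing.residue (X.presheaf.stalk x)).comp
    ((X.presheaf.germ ⊤ x trivial).hom.comp (scalarSection κ X))

/-- The fiber as a `κ`-vector space. -/
instance fiberModuleBase (M : X.Modules) (x : X) : Module κ (Fiber M x) :=
  Module.compHom _ (scalarResidue κ x)

/-- The map `φ(x)` induced by `φ` on fibers at `x`. -/
def fiberMap {M N : X.Modules} (φ : M ⟶ N) (x : X) : Fiber M x →ₗ[κ] Fiber N x where
  toFun := (stalkMap φ x).baseChange (IsLocalRing.ResidueField (X.presheaf.stalk x))
  map_add' := map_add _
  map_smul' c v :=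
    map_smul ((stalkMap φ x).baseChange (IsLocalRing.ResidueField (X.presheaf.stalk x)))
      (scalarResidue κ x c) v

end Fibers

section Bundles

variable {X : Scheme.{u}}

instance modulesHasFiniteBiproducts : HasFiniteBiproducts X.Modules :=
  Abelian.hasFiniteBiproducts

/-- The direct sum `M^a` of `a` copies of `M`. -/
def power (M : X.Modules) (a : ℕ) : X.Modules := ⨁ fun _ : Fin a => M

variable (X) in
/-- `𝒪_X` as a module over itself. -/
def structureSheaf : X.Modules := (SheafOfModules.unit X.ringCatSheaf : SheafOfModules _)

/-- `M` is locally free of rank `r`, i.e. locally isomorphic to `𝒪^r`. -/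
def IsLocallyFreeOfRank (M : X.Modules) (r : ℕ) : Prop :=
  ∀ x : X, ∃ U : X.Opens, x ∈ U ∧
    Nonempty (M.restrict U.ι ≅ power (structureSheaf U.toScheme) r)

/-- `M` is a vector bundle, i.e. locally free of finite rank. -/
def IsVectorBundle (M : X.Modules) : Prop :=
  ∀ x : X, ∃ (U : X.Opens) (r : ℕ), x ∈ U ∧
    Nonempty (M.restrict U.ι ≅ power (structureSheaf U.toScheme) r)

/-- `M` is simple: the scalars `κ → Hom(M, M)` are all endomorphisms, and `M ≠ 0`. -/
def IsSimpleBundle (κ : Type u) [Field κ] [X.Over (Spec (.of κ))] (M : X.Modules) : Prop :=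
  Function.Bijective (fun c : κ => c • 𝟙 M)

/-- `Ext¹(F, E) = 0`, with `Ext` taken in the abelian category of `𝒪_X`-modules. -/
def Ext1Vanishes (F E : X.Modules) : Prop :=
  letI : HasExt.{u + 1} X.Modules := HasExt.standard X.Modules
  Subsingleton (Abelian.Ext F E 1)

end Bundles

section Dual

variable {X : Scheme.{u}} (M : X.Modules)

/-- Sections over `U` of the dual sheaf: morphisms `M|_U ⟶ 𝒪_U`, i.e. families of
`𝒪(V)`-linear maps `M(V) → 𝒪(V)` for `V ⊆ U` open, compatible with restriction. -/
def dualSections (U : X.Opens) :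
    AddSubgroup (∀ V : {V : X.Opens // V ≤ U}, Γ(M, V.1) →ₗ[Γ(X, V.1)] Γ(X, V.1)) where
  carrier := {φ | ∀ (V W : {V : X.Opens // V ≤ U}) (h : W.1 ≤ V.1) (m : Γ(M, V.1)),
    φ W (M.presheaf.map (homOfLE h).op m) = X.presheaf.map (homOfLE h).op (φ V m)}
  add_mem' {φ ψ} hφ hψ V W h m := by
    simp only [Pi.add_apply, LinearMap.add_apply, map_add, hφ V W h m, hψ V W h m]
  zero_mem' V W h m := by simp
  neg_mem' {φ} hφ V W h m := by
    simp only [Pi.neg_apply, LinearMap.neg_apply, map_neg, hφ V W h m]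

instance dualSectionsModule (U : X.Opens) : Module Γ(X, U) (dualSections M U) where
  smul r φ := ⟨fun V => (X.presheaf.map (homOfLE V.2).op r : Γ(X, V.1)) • φ.1 V,
    fun V W h m => by
      have hr : X.presheaf.map (homOfLE W.2).op r =
          X.presheaf.map (homOfLE h).op (X.presheaf.map (homOfLE V.2).op r) := by
        rw [← CommRingCat.comp_apply, ← Functor.map_comp]; rfl
      simp only [LinearMap.smul_apply, smul_eq_mul, map_mul, hr, φ.2 V W h m]⟩
  one_smul φ := Subtype.ext (funext fun V => by
    change (X.presheaf.map _ (1 : Γ(X, U)) : Γ(X, V.1)) • φ.1 V = _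
    rw [map_one, one_smul])
  mul_smul r s φ := Subtype.ext (funext fun V => by
    change (X.presheaf.map _ (r * s : Γ(X, U)) : Γ(X, V.1)) • φ.1 V =
      (X.presheaf.map _ r : Γ(X, V.1)) • (X.presheaf.map _ s : Γ(X, V.1)) • φ.1 V
    rw [map_mul, mul_smul])
  smul_zero r := Subtype.ext (funext fun V => smul_zero _)
  smul_add r φ ψ := Subtype.ext (funext fun V => smul_add _ _ _)
  add_smul r s φ := Subtype.ext (funext fun V => by
    change (X.presheaf.map _ (r + s : Γ(X, U)) : Γ(X, V.1)) • φ.1 V =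
      (X.presheaf.map _ r : Γ(X, V.1)) • φ.1 V + (X.presheaf.map _ s : Γ(X, V.1)) • φ.1 V
    rw [map_add, add_smul])
  zero_smul φ := Subtype.ext (funext fun V => by
    change (X.presheaf.map _ (0 : Γ(X, U)) : Γ(X, V.1)) • φ.1 V = 0
    rw [map_zero, zero_smul])

/-- The presheaf of abelian groups `U ↦ Hom(M|_U, 𝒪_U)`. -/
def dualAbPresheaf : (Opens X)ᵒᵖ ⥤ Ab.{u} where
  obj U := AddCommGrpCat.of (dualSections M U.unop)
  map {U V} i := AddCommGrpCat.ofHom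
    { toFun := fun φ => ⟨fun W => φ.1 ⟨W.1, W.2.trans i.unop.le⟩,
        fun W W' h m => φ.2 ⟨W.1, W.2.trans i.unop.le⟩ ⟨W'.1, W'.2.trans i.unop.le⟩ h m⟩
      map_zero' := rfl
      map_add' := fun _ _ => rfl }

instance dualAbPresheafModule (U : (Opens X)ᵒᵖ) :
    Module ((X.presheaf ⋙ forget₂ CommRingCat RingCat).obj U) ((dualAbPresheaf M).obj U) :=
  inferInstanceAs (Module Γ(X, U.unop) (dualSections M U.unop))

/-- The dual `M^∨ = ℋom(M, 𝒪_X)`, as a presheaf of modules. -/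
def dualPresheaf : _root_.PresheafOfModules.{u} (X.presheaf ⋙ forget₂ CommRingCat RingCat) :=
  _root_.PresheafOfModules.ofPresheaf (dualAbPresheaf M) (fun {U V} i r φ =>
    Subtype.ext (funext fun (W : {W : X.Opens // W ≤ V.unop}) => by
      change (X.presheaf.map (homOfLE (W.2.trans i.unop.le)).op r : Γ(X, W.1)) •
          φ.1 ⟨W.1, W.2.trans i.unop.le⟩ =
        (X.presheaf.map (homOfLE W.2).op (X.presheaf.map i r) : Γ(X, W.1)) •
          φ.1 ⟨W.1, W.2.trans i.unop.le⟩
      rw [← CommRingCat.comp_apply, ← Functor.map_comp]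
      rfl))

/-- The sheaf `M^∨ ⊗ N`: the sheafification of `U ↦ M^∨(U) ⊗ N(U)`. -/
def dualTensor (N : X.Modules) : X.Modules :=
  ((PresheafOfModules.sheafification (𝟙 X.ringCatSheaf.obj)).obj
    (PresheafOfModules.Monoidal.tensorObj (dualPresheaf M) (commPresheaf N)) : SheafOfModules _)

/-- `M` is globally generated: some family of global sections defines an epimorphism from a free
module onto `M`. -/
def IsGloballyGenerated : Prop := Nonempty (SheafOfModules.GeneratingSections M)

end Dual

section Representations

/-- A representation of the Kronecker quiver with `w` arrows: finite dimensional vector spaces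
`V`, `W` at the two vertices and a linear map `A i : V → W` for each arrow. -/
structure KroneckerRep (κ : Type u) [Field κ] (w : ℕ) where
  V : Type u
  W : Type u
  [addCommGroupV : AddCommGroup V]
  [moduleV : Module κ V]
  [finiteV : FiniteDimensional κ V]
  [addCommGroupW : AddCommGroup W]
  [moduleW : Module κ W]
  [finiteW : FiniteDimensional κ W]
  A : Fin w → V →ₗ[κ] W

attribute [instance] KroneckerRep.addCommGroupV KroneckerRep.moduleV KroneckerRep.finiteV
  KroneckerRep.addCommGroupW KroneckerRep.moduleW KroneckerRep.finiteW

variable {κ : Type u} [Field κ] {w : ℕ}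

/-- Morphisms of representations. -/
@[ext]
structure KroneckerRep.Hom (R S : KroneckerRep κ w) where
  f₁ : R.V →ₗ[κ] S.V
  f₂ : R.W →ₗ[κ] S.W
  comm : ∀ i, f₂ ∘ₗ R.A i = S.A i ∘ₗ f₁

instance kroneckerRepCategory : Category (KroneckerRep κ w) where
  Hom := KroneckerRep.Hom
  id R := ⟨LinearMap.id, LinearMap.id, fun _ => rfl⟩
  comp f g := ⟨g.f₁ ∘ₗ f.f₁, g.f₂ ∘ₗ f.f₂, fun i => by
    rw [LinearMap.comp_assoc, f.comm, ← LinearMap.comp_assoc, g.comm, LinearMap.comp_assoc]⟩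

variable {X : Scheme.{u}} [X.Over (Spec (.of κ))]

variable (κ) in
/-- `V ⊗ E` for a finite dimensional `κ`-vector space `V`, realized as `E^(dim V)` by means of
the basis `Module.finBasis κ V` of `V`. -/
def tensorObj (V : Type u) [AddCommGroup V] [Module κ V] (E : X.Modules) : X.Modules :=
  power E (Module.finrank κ V)

/-- `A ⊗ σ : V ⊗ E ⟶ W ⊗ F`, given by the matrix of `A` in the chosen bases. -/
def tensorMap {V W : Type u} [AddCommGroup V] [Module κ V] [FiniteDimensional κ V]
    [AddCommGroup W] [Module κ W] [FiniteDimensional κ W] (A : V →ₗ[κ] W) {E F : X.Modules}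
    (σ : E ⟶ F) : tensorObj κ V E ⟶ tensorObj κ W F :=
  biproduct.matrix fun j k =>
    LinearMap.toMatrix (Module.finBasis κ V) (Module.finBasis κ W) A k j • σ

theorem tensorMap_id (V : Type u) [AddCommGroup V] [Module κ V] [FiniteDimensional κ V]
    (E : X.Modules) : tensorMap (LinearMap.id : V →ₗ[κ] V) (𝟙 E) = 𝟙 _ := by
  refine biproduct.hom_ext' _ _ fun j => biproduct.hom_ext _ _ fun k => ?_
  by_cases h : j = k
  · subst h
    simp [tensorMap, tensorObj, power]
  · simp [tensorMap, tensorObj, power, Matrix.one_apply, Ne.symm h,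
      biproduct.ι_π_ne _ h]

theorem tensorMap_comp {U V W : Type u} [AddCommGroup U] [Module κ U] [FiniteDimensional κ U]
    [AddCommGroup V] [Module κ V] [FiniteDimensional κ V]
    [AddCommGroup W] [Module κ W] [FiniteDimensional κ W] (A : U →ₗ[κ] V) (B : V →ₗ[κ] W)
    {E F G : X.Modules} (σ : E ⟶ F) (τ : F ⟶ G) :
    tensorMap A σ ≫ tensorMap B τ = tensorMap (B ∘ₗ A) (σ ≫ τ) := by
  refine biproduct.hom_ext' _ _ fun j => biproduct.hom_ext _ _ fun k => ?_
  simp only [tensorMap, tensorObj, power, biproduct.ι_matrix_assoc, Category.assoc,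
    biproduct.matrix_π, biproduct.lift_desc, Linear.smul_comp, Linear.comp_smul, smul_smul,
    LinearMap.toMatrix_comp (Module.finBasis κ U) (Module.finBasis κ V) (Module.finBasis κ W),
    Matrix.mul_apply, Finset.sum_smul, biproduct.ι_desc, mul_comm]

/-- The morphism `α = ∑ A_i ⊗ σ_i : V ⊗ E ⟶ W ⊗ F` attached to a representation. -/
def repMap {E F : X.Modules} (σ : Fin w → (E ⟶ F)) (R : KroneckerRep κ w) :
    tensorObj κ R.V E ⟶ tensorObj κ R.W F :=
  ∑ i, tensorMap (R.A i) (σ i)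

theorem repMap_naturality {E F : X.Modules} (σ : Fin w → (E ⟶ F)) {R S : KroneckerRep κ w}
    (f : R ⟶ S) :
    repMap σ R ≫ tensorMap f.f₂ (𝟙 F) = tensorMap f.f₁ (𝟙 E) ≫ repMap σ S := by
  simp only [repMap, Preadditive.sum_comp, Preadditive.comp_sum, tensorMap_comp, f.comm,
    Category.comp_id, Category.id_comp]

/-- The functor `R ↦ coker (∑ A_i ⊗ σ_i)`; a morphism `(f₁, f₂)` of representations is sent to the
map of cokernels induced by `f₁ ⊗ 1` and `f₂ ⊗ 1`. -/
def cokernelFunctor {E F : X.Modules} (σ : Fin w → (E ⟶ F)) : KroneckerRep κ w ⥤ X.Modules where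
  obj R := cokernel (repMap σ R)
  map f := cokernel.map _ _ (tensorMap f.f₁ (𝟙 E)) (tensorMap f.f₂ (𝟙 F)) (repMap_naturality σ f)
  map_id R := by
    rw [← cancel_epi (cokernel.π (repMap σ R))]
    exact (cokernel.π_desc _ _ _).trans
      ((congrArg (· ≫ _) (tensorMap_id R.W F)).trans
        ((Category.id_comp _).trans (Category.comp_id _).symm))
  map_comp {R S T} f g := by
    rw [← cancel_epi (cokernel.π (repMap σ R))]
    have h : tensorMap (f ≫ g).f₂ (𝟙 F) = tensorMap f.f₂ (𝟙 F) ≫ tensorMap g.f₂ (𝟙 F) := by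
      rw [tensorMap_comp, Category.id_comp]
      rfl
    simp only [cokernel.map, cokernel.π_desc, cokernel.π_desc_assoc, Category.assoc, h]

/-- `R` is globally injective: `∑ A_i ⊗ σ_i(P) : V ⊗ E_P → W ⊗ F_P` is injective for every point
`P` of the variety `X`, i.e. for every closed point of the scheme `X`. -/
def IsGloballyInjective {E F : X.Modules} (σ : Fin w → (E ⟶ F)) :
    ObjectProperty (KroneckerRep κ w) :=
  fun R => ∀ x : X, IsClosed ({x} : Set X) →
    Function.Injective (∑ i, TensorProduct.map (R.A i) (fiberMap κ (σ i) x))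

/-- Globally injective representations with `dim W * f - dim V * e ≥ n`. -/
def IsGloballyInjectiveOfRankGE (e f n : ℕ) {E F : X.Modules} (σ : Fin w → (E ⟶ F)) :
    ObjectProperty (KroneckerRep κ w) :=
  fun R => IsGloballyInjective σ R ∧
    (n : ℤ) ≤ Module.finrank κ R.W * f - Module.finrank κ R.V * e

end Representations

section CokernelBundles

variable {X : Scheme.{u}}

/-- `0 ⟶ E^a ⟶ F^b ⟶ C ⟶ 0` is exact for some choice of the maps. -/
def HasResolution (E F : X.Modules) (a b : ℕ) (C : X.Modules) : Prop :=
  ∃ (α : power E a ⟶ power F b) (π : power F b ⟶ C) (h : α ≫ π = 0),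
    (ShortComplex.mk α π h).ShortExact

/-- Cokernel bundles of type `(E, F)`. -/
def IsCokernelBundle (E F : X.Modules) : ObjectProperty X.Modules :=
  fun C => IsVectorBundle C ∧ ∃ a b : ℕ, HasResolution E F a b C

/-- Cokernel bundles of type `(E, F)` with a resolution such that `b * f - a * e ≥ n`, where `e`
and `f` stand for the ranks of `E` and `F`. -/
def IsCokernelBundleOfRankGE (e f n : ℕ) (E F : X.Modules) : ObjectProperty X.Modules :=
  fun C => IsVectorBundle C ∧ ∃ a b : ℕ, (n : ℤ) ≤ b * f - a * e ∧ HasResolution E F a b C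

end CokernelBundles

end

end KroneckerCokernel

open KroneckerCokernel

/-! Everything rests on the correspondence between representations and maps `α : E^a ⟶ F^b`. Such a
map is a matrix with entries in `Hom(E, F)`, and expanding each entry in the basis `σ` gives one
scalar matrix `A i` per arrow (`exists_sum_tensorMap_eq`, `sum_tensorMap_injective`). Simplicity
does the same for maps between powers of `E`, or of `F`: they are plain scalar matrices.

Global injectivity means exactly that `α` is a monomorphism with locally free cokernel. If `α` is
injective on the fiber at a closed point, the image of a local frame of `E^a` is part of a basis of
the fiber of `F^b`. Lifting that basis and inverting a determinant gives a frame of `F^b` on a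
neighborhood; the complementary part is a frame of the cokernel. Every point specializes to a closed
one, so these neighborhoods cover `X` (`mono_and_isVectorBundle_cokernel`). Conversely, a frame of
`E^a` together with lifts of a frame of a locally free cokernel is a frame of `F^b`, which forces
injectivity on fibers (`fiberLin_injective_of_shortExact`). This gives essential surjectivity, with
the dimensions of the representation equal to the exponents of the resolution, so the rank bound in
(b) carries over unchanged.

Full faithfulness is a comparison of resolutions. A map of cokernels lifts to the `F`-terms because
`Ext¹(F, E) = 0`, and then restricts to the `E`-terms; equality of coefficients in `σ` makes the
pair of scalar matrices a morphism of representations. Two such pairs inducing the same map differ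
on the `F`-terms by a map into the `E`-term, which vanishes because `Hom(F, E) = 0`. -/

namespace KroneckerCokernel

noncomputable section

/-! ### Restriction, germs and gluing of sections. -/

section Sections

variable {X : Scheme.{u}}

/-- Restriction of functions to a smaller open subset. -/
def fres {U V : X.Opens} (h : V ≤ U) : Γ(X, U) →+* Γ(X, V) :=
  (X.presheaf.map (homOfLE h).op).hom

theorem fres_fres {U V W : X.Opens} (h : V ≤ U) (k : W ≤ V) (r : Γ(X, U)) :
    fres k (fres h r) = fres (k.trans h) r := by
  change X.presheaf.map _ (X.presheaf.map _ r) = X.presheaf.map _ r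
  rw [← CommRingCat.comp_apply, ← Functor.map_comp]
  rfl

theorem germ_fres {U V : X.Opens} (h : V ≤ U) (x : X) (hx : x ∈ V) (r : Γ(X, U)) :
    X.presheaf.germ V x hx (fres h r) = X.presheaf.germ U x (h hx) r :=
  TopCat.Presheaf.germ_res_apply _ (homOfLE h) x hx r

/-- Restriction of sections of a module to a smaller open subset. -/
def res (M : X.Modules) {U V : X.Opens} (h : V ≤ U) : Γ(M, U) →+ Γ(M, V) :=
  (M.presheaf.map (homOfLE h).op).hom

variable {M N : X.Modules}

theorem res_res {U V W : X.Opens} (h : V ≤ U) (k : W ≤ V) (m : Γ(M, U)) :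
    res M k (res M h m) = res M (k.trans h) m := by
  change M.presheaf.map _ (M.presheaf.map _ m) = M.presheaf.map _ m
  rw [← ConcreteCategory.comp_apply, ← Functor.map_comp]
  rfl

@[simp] theorem res_refl {U : X.Opens} (h : U ≤ U) (m : Γ(M, U)) : res M h m = m := by
  change M.presheaf.map (𝟙 _) m = m
  simp

theorem res_smul {U V : X.Opens} (h : V ≤ U) (r : Γ(X, U)) (m : Γ(M, U)) :
    res M h (r • m) = fres h r • res M h m :=
  M.map_smul (homOfLE h) r m

theorem app_res (φ : M ⟶ N) {U V : X.Opens} (h : V ≤ U) (m : Γ(M, U)) :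
    φ.app V (res M h m) = res N h (φ.app U m) :=
  ConcreteCategory.congr_hom (φ.mapPresheaf.naturality (homOfLE h).op) m

theorem germ_res (M : X.Modules) {U V : X.Opens} (h : V ≤ U) (x : X) (hx : x ∈ V) (m : Γ(M, U)) :
    M.presheaf.germ V x hx (res M h m) = M.presheaf.germ U x (h hx) m :=
  TopCat.Presheaf.germ_res_apply _ (homOfLE h) x hx m

theorem exists_res_eq_of_germ_eq {U : X.Opens} {x : X} (hx : x ∈ U) {m m' : Γ(M, U)}
    (h : M.presheaf.germ U x hx m = M.presheaf.germ U x hx m') :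
    ∃ (V : X.Opens) (hV : V ≤ U), x ∈ V ∧ res M hV m = res M hV m' := by
  obtain ⟨V, hxV, i, j, e⟩ := TopCat.Presheaf.germ_eq _ x hx hx m m' h
  exact ⟨V, i.le, hxV, e⟩

theorem section_ext {U : X.Opens} {m m' : Γ(M, U)}
    (h : ∀ x ∈ U, ∃ (V : X.Opens) (hV : V ≤ U), x ∈ V ∧ res M hV m = res M hV m') : m = m' := by
  choose V hV hxV e using fun x : U => h x.1 x.2
  exact TopCat.Sheaf.eq_of_locally_eq' ⟨M.presheaf, M.isSheaf⟩ V U (fun x => homOfLE (hV x))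
    (fun x hx => Opens.mem_iSup.2 ⟨⟨x, hx⟩, hxV _⟩) m m' e

/-- Functions which locally satisfy a property that determines them uniquely glue. -/
theorem exists_function_of_local {U : X.Opens} (P : ∀ V : X.Opens, V ≤ U → Γ(X, V) → Prop)
    (hres : ∀ (V W : X.Opens) (hV : V ≤ U) (h : W ≤ V) (r : Γ(X, V)),
      P V hV r → P W (h.trans hV) (fres h r))
    (huniq : ∀ (V : X.Opens) (hV : V ≤ U) (r r' : Γ(X, V)), P V hV r → P V hV r' → r = r')
    (hloc : ∀ x ∈ U, ∃ (V : X.Opens) (hV : V ≤ U) (_ : x ∈ V) (r : Γ(X, V)), P V hV r) :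
    ∃ r : Γ(X, U), ∀ x ∈ U, ∃ (V : X.Opens) (hV : V ≤ U), x ∈ V ∧ P V hV (fres hV r) := by
  choose V hV hxV r hr using fun x : U => hloc x.1 x.2
  obtain ⟨s, hs, -⟩ := TopCat.Sheaf.existsUnique_gluing' X.sheaf V U (fun x => homOfLE (hV x))
    (fun x hx => Opens.mem_iSup.2 ⟨⟨x, hx⟩, hxV _⟩) r (fun x y =>
      huniq _ (inf_le_left.trans (hV x)) (fres inf_le_left (r x)) (fres inf_le_right (r y))
        (hres _ _ _ _ _ (hr x)) (hres _ _ _ _ _ (hr y)))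
  refine ⟨s, fun x hx => ⟨V ⟨x, hx⟩, hV _, hxV _, ?_⟩⟩
  have e : fres (hV ⟨x, hx⟩) s = r ⟨x, hx⟩ := hs ⟨x, hx⟩
  exact e ▸ hr _

theorem app_sum_smul {ι : Type*} [Fintype ι] (φ : M ⟶ N) {U : X.Opens} (c : ι → Γ(X, U))
    (s : ι → Γ(M, U)) : φ.app U (∑ i, c i • s i) = ∑ i, c i • φ.app U (s i) := by
  simp only [map_sum, Scheme.Modules.Hom.app_smul]

theorem res_sum_smul {ι : Type*} [Fintype ι] {U V : X.Opens} (h : V ≤ U) (c : ι → Γ(X, U))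
    (s : ι → Γ(M, U)) : res M h (∑ i, c i • s i) = ∑ i, fres h (c i) • res M h (s i) := by
  simp only [map_sum, res_smul]

end Sections

/-! ### Monomorphisms, epimorphisms and exactness in terms of sections. -/

section Exactness

variable {X : Scheme.{u}} {M N : X.Modules}

theorem mono_of_app_injective (φ : M ⟶ N) (h : ∀ U, Function.Injective (φ.app U)) : Mono φ where
  right_cancellation f g e := by
    apply Scheme.Modules.hom_ext
    intro U
    ext m
    exact h U (ConcreteCategory.congr_hom (congrArg (fun ψ => ψ.app U) e) m)

/-- Sections over `U`, as a functor. -/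
def sectionsFunctor (U : X.Opens) : X.Modules ⥤ Ab.{u} :=
  Scheme.Modules.toPresheaf X ⋙ (evaluation _ _).obj (.op U)

instance (U : X.Opens) : PreservesFiniteLimits (sectionsFunctor U) :=
  have : PreservesFiniteLimits ((evaluation (Opens X)ᵒᵖ Ab.{u}).obj (.op U)) :=
    ⟨fun _ _ _ => evaluation_preservesLimitsOfShape _⟩
  comp_preservesFiniteLimits (Scheme.Modules.toPresheaf X) ((evaluation _ _).obj (.op U))

instance (U : X.Opens) : (sectionsFunctor U).Additive where
  map_add := rfl

theorem app_injective (φ : M ⟶ N) [Mono φ] (U : X.Opens) : Function.Injective (φ.app U) :=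
  (AddCommGrpCat.mono_iff_injective _).1 (inferInstanceAs (Mono ((sectionsFunctor U).map φ)))

/-- Taking sections is left exact, so a section killed by `S.g` lifts over all of `U`, with no
shrinking. -/
theorem exists_app_eq {S : ShortComplex X.Modules} (hS : S.Exact) [Mono S.f] (U : X.Opens)
    (n : Γ(S.X₂, U)) (hn : S.g.app U n = 0) : ∃ m, S.f.app U m = n :=
  (ShortComplex.ab_exact_iff _).1
    (hS.map_of_mono_of_preservesKernel (sectionsFunctor U) ‹_› inferInstance) n hn

/-- An epimorphism of sheaves of modules is locally surjective on sections. -/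
theorem exists_app_eq_res (φ : M ⟶ N) [Epi φ] (U : X.Opens) (n : Γ(N, U)) (x : X) (hx : x ∈ U) :
    ∃ (V : X.Opens) (hV : V ≤ U) (_ : x ∈ V) (m : Γ(M, V)), φ.app V m = res N hV n := by
  let α := 𝟙 X.ringCatSheaf.obj
  let J := Opens.grothendieckTopology X
  let adj := PresheafOfModules.sheafificationAdjunction α
  let φ' := (SheafOfModules.forget X.ringCatSheaf ⋙ PresheafOfModules.restrictScalars α).map φ
  -- The inclusion of the presheaf image of `φ`. The aim is that it becomes an isomorphism after
  -- sheafification, so that every section of `N` is locally in the image.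
  let i := Abelian.image.ι φ'
  have hc : IsIso (PresheafOfModules.sheafificationAdjunction (𝟙 X.ringCatSheaf.obj)).counit :=
    inferInstance
  have hcM : IsIso (adj.counit.app M) :=
    (NatTrans.isIso_iff_isIso_app _).1 hc M
  have hcN : IsIso (adj.counit.app N) :=
    (NatTrans.isIso_iff_isIso_app _).1 hc N
  -- By the invertible counit, sheafifying `φ'` gives back `φ` up to isomorphism, hence an
  -- epimorphism; it factors through the sheafification of `i`.
  have hepi : Epi ((PresheafOfModules.sheafification α).map i) := by
    have : Epi ((PresheafOfModules.sheafification α).map φ') := by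
      have e := adj.counit.naturality φ
      have : Epi ((PresheafOfModules.sheafification α).map φ' ≫ adj.counit.app N) := by
        refine (show _ = _ from e) ▸ ?_
        exact @epi_comp _ _ _ _ _ (adj.counit.app M) (@IsIso.epi_of_iso _ _ _ _ _ hcM) φ ‹_›
      have h2 : (PresheafOfModules.sheafification α).map φ' =
        ((PresheafOfModules.sheafification α).map φ' ≫ adj.counit.app N) ≫
          inv (adj.counit.app N) := by simp
      rw [h2]
      infer_instance
    rw [← Abelian.image.fac φ', Functor.map_comp] at this
    exact @epi_of_epi _ _ _ _ _ _ _ this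
  have : IsIso ((PresheafOfModules.sheafification α).map i) := isIso_of_mono_of_epi _
  have hW : J.W ((PresheafOfModules.toPresheaf _).map i) := by
    rw [GrothendieckTopology.W_iff]
    exact inferInstanceAs
      (IsIso ((SheafOfModules.toSheaf _).map ((PresheafOfModules.sheafification α).map i)))
  have hs := GrothendieckTopology.W.isLocallySurjective hW
  obtain ⟨V, j, ⟨y, hy⟩, hxV⟩ := hs.imageSieve_mem (U := U) n x hx
  -- Epimorphisms of presheaves are surjective on each open set, so `y` lifts without further
  -- shrinking.
  obtain ⟨m, rfl⟩ := PresheafOfModules.surjective_of_epi (Abelian.factorThruImage φ') (.op V) y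
  refine ⟨V, j.le, hxV, m, ?_⟩
  refine Eq.trans ?_ hy
  exact (ConcreteCategory.congr_hom (congrArg (fun ψ => ψ.app (.op V))
    (Abelian.image.fac φ')) m).symm

end Exactness

/-! ### Local frames and vector bundles. -/

section Frames

variable {X : Scheme.{u}}

/-- Sections `s i` of `M` over `U` form a frame if over every open subset of `U` they are a basis
of the module of sections. -/
def IsFrame {ι : Type*} [Fintype ι] (M : X.Modules) (U : X.Opens) (s : ι → Γ(M, U)) : Prop :=
  ∀ (V : X.Opens) (h : V ≤ U),
    Function.Bijective fun c : ι → Γ(X, V) => ∑ i, c i • res M h (s i)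

variable {M N : X.Modules} {ι ι' : Type*} [Fintype ι] [Fintype ι'] {U : X.Opens}

theorem IsFrame.of_le {s : ι → Γ(M, U)} (hs : IsFrame M U s) {V : X.Opens} (h : V ≤ U) :
    IsFrame M V fun i => res M h (s i) := by
  intro W k
  simpa only [res_res] using hs W (k.trans h)

theorem IsFrame.reindex {s : ι → Γ(M, U)} (hs : IsFrame M U s) (e : ι' ≃ ι) :
    IsFrame M U (s ∘ e) := by
  intro V h
  have := (hs V h).comp (Equiv.arrowCongr e (Equiv.refl Γ(X, V))).bijective
  convert this using 2 with c
  exact Fintype.sum_equiv e _ _ (fun i => by simp [Equiv.arrowCongr])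

theorem app_bijective_of_iso (φ : M ≅ N) (U : X.Opens) : Function.Bijective (φ.hom.app U) := by
  have : IsIso (φ.hom.app U) := inferInstance
  exact ConcreteCategory.bijective_of_isIso (φ.hom.app U)

theorem IsFrame.of_iso {s : ι → Γ(M, U)} (hs : IsFrame M U s) (φ : M ≅ N) :
    IsFrame N U fun i => φ.hom.app U (s i) := by
  intro V h
  have := (app_bijective_of_iso φ V).comp (hs V h)
  convert this using 2 with c
  simp only [Function.comp, app_sum_smul, app_res]

/-- The inclusions `M ⟶ M^a`. -/
def powerι (M : X.Modules) {a : ℕ} (j : Fin a) : M ⟶ power M a :=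
  biproduct.ι (fun _ : Fin a => M) j

/-- The projections `M^a ⟶ M`. -/
def powerπ (M : X.Modules) {a : ℕ} (j : Fin a) : power M a ⟶ M :=
  biproduct.π (fun _ : Fin a => M) j

theorem powerι_powerπ {a : ℕ} (j k : Fin a) :
    powerι M j ≫ powerπ M k = if j = k then 𝟙 M else 0 := by
  refine (biproduct.ι_π _ j k).trans ?_
  simp

theorem powerπ_powerι_total (M : X.Modules) (a : ℕ) :
    ∑ j : Fin a, powerπ M j ≫ powerι M j = 𝟙 (power M a) :=
  biproduct.total

theorem power_hom_ext {a : ℕ} {f g : N ⟶ power M a} (h : ∀ j, f ≫ powerπ M j = g ≫ powerπ M j) :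
    f = g :=
  biproduct.hom_ext _ _ h

theorem power_hom_ext' {a : ℕ} {f g : power M a ⟶ N} (h : ∀ j, powerι M j ≫ f = powerι M j ≫ g) :
    f = g :=
  biproduct.hom_ext' _ _ h

theorem sum_app {κ' : Type*} (t : Finset κ') (ψ : κ' → (M ⟶ N)) (m : Γ(M, U)) :
    (∑ j ∈ t, ψ j).app U m = ∑ j ∈ t, (ψ j).app U m := by
  classical
  induction t using Finset.induction_on with
  | empty => rfl
  | insert i t hi ih => rw [Finset.sum_insert hi, Finset.sum_insert hi, ← ih]; rfl

theorem power_section {a : ℕ} (m : Γ(power M a, U)) :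
    m = ∑ j, (powerι M j).app U ((powerπ M j).app U m) := by
  have h := congrArg (fun φ : power M a ⟶ power M a => φ.app U m) (powerπ_powerι_total M a)
  exact h.symm.trans (sum_app _ _ _)

theorem powerπ_powerι_section {a : ℕ} (j k : Fin a) (m : Γ(M, U)) :
    (powerπ M k).app U ((powerι M j).app U m) = if j = k then m else 0 := by
  have h := congrArg (fun φ : M ⟶ M => φ.app U m) (powerι_powerπ (M := M) j k)
  refine Eq.trans h ?_
  by_cases hjk : j = k
  · subst hjk
    simp
  · simp [hjk]

theorem IsFrame.pow {s : ι → Γ(M, U)} (hs : IsFrame M U s) (a : ℕ) :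
    IsFrame (power M a) U fun p : Fin a × ι => (powerι M p.1).app U (s p.2) := by
  intro V h
  have key : ∀ c : Fin a × ι → Γ(X, V), ∀ k, (powerπ M k).app V
      (∑ p, c p • res (power M a) h ((powerι M p.1).app U (s p.2))) =
      ∑ i, c (k, i) • res M h (s i) := by
    intro c k
    rw [app_sum_smul, Fintype.sum_prod_type, Finset.sum_eq_single k]
    · refine Finset.sum_congr rfl fun i _ => ?_
      rw [← app_res, powerπ_powerι_section, if_pos rfl]
    · intro j _ hj
      refine Finset.sum_eq_zero fun i _ => ?_
      rw [← app_res, powerπ_powerι_section, if_neg hj, smul_zero]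
    · simp
  constructor
  · intro c c' hc
    funext p
    have h1 := congrArg ((powerπ M p.1).app V) hc
    simp only [key] at h1
    exact congrFun ((hs V h).1 h1) p.2
  · intro m
    choose c hc using fun k : Fin a => (hs V h).2 ((powerπ M k).app V m)
    refine ⟨fun p => c p.1 p.2, ?_⟩
    rw [power_section m]
    refine (power_section _).trans ?_
    exact Finset.sum_congr rfl fun k _ =>
      congrArg _ ((key (fun p => c p.1 p.2) k).trans (hc k))

/-- The map `𝒪 ⟶ M` sending `1` to a global section. -/
def ofSection (M : X.Modules) (s : Γ(M, ⊤)) : structureSheaf X ⟶ M :=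
  (⟨PresheafOfModules.homMk
    { app := fun U => AddCommGrpCat.ofHom
        ((smulAddHom Γ(X, U.unop) Γ(M, U.unop)).flip (res M le_top s))
      naturality := by
        intro U V i
        ext c
        have h1 := M.map_smul i.unop c (res M le_top s)
        have h2 : M.presheaf.map i.unop.op (res M (le_top : U.unop ≤ ⊤) s) =
          res M le_top s := res_res le_top i.unop.le s
        rw [h2] at h1
        exact h1.symm }
    (fun U r c => mul_smul (show Γ(X, U.unop) from r) (show Γ(X, U.unop) from c)
      (res M le_top s))⟩ :
    SheafOfModules.Hom (SheafOfModules.unit X.ringCatSheaf) M)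

theorem isFrame_structureSheaf :
    IsFrame (structureSheaf X) U fun _ : Unit => (1 : Γ(X, U)) := by
  intro V h
  have key : ∀ c : Unit → Γ(X, V), ∑ i, c i • res (structureSheaf X) h
      (1 : Γ(X, U)) = c () := by
    intro c
    have h1 : res (structureSheaf X) h (1 : Γ(X, U)) = (1 : Γ(X, V)) :=
      map_one (fres h)
    rw [h1, Fintype.sum_unique]
    exact mul_one (c ())
  constructor
  · intro c c' h
    funext i
    exact (key c).symm.trans (h.trans (key c'))
  · intro m
    exact ⟨fun _ => m, key _⟩

/-- A module with a global frame is free. -/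
theorem IsFrame.nonempty_iso {r : ℕ} {s : Fin r → Γ(M, ⊤)} (hs : IsFrame M ⊤ s) :
    Nonempty (M ≅ power (structureSheaf X) r) := by
  let φ : power (structureSheaf X) r ⟶ M :=
    biproduct.desc fun i => ofSection M (s i)
  suffices IsIso φ from ⟨(asIso φ).symm⟩
  refine Scheme.Modules.Hom.isIso_iff_isIso_app.2 fun V => ?_
  refine (ConcreteCategory.isIso_iff_bijective (φ.app V)).2 ?_
  have hφ : ∀ (i : Fin r) (c : Γ(structureSheaf X, V)), φ.app V ((powerι _ i).app V c) =
      (show Γ(X, V) from c) • res M le_top (s i) := fun i c =>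
    congrArg (fun ψ : structureSheaf X ⟶ M => ψ.app V c)
      (biproduct.ι_desc (fun i => ofSection M (s i)) i)
  have key : ∀ m, φ.app V m =
      ∑ i, (show Γ(X, V) from (powerπ (structureSheaf X) i).app V m) • res M le_top (s i) := by
    intro m
    conv_lhs => rw [power_section m, map_sum]
    exact Finset.sum_congr rfl fun i _ => hφ i _
  constructor
  · intro m m' h
    rw [key, key] at h
    have h1 := (hs V le_top).1 h
    rw [power_section m, power_section m']
    exact Finset.sum_congr rfl fun i _ => congrArg _ (congrFun h1 i)
  · intro n
    obtain ⟨c, rfl⟩ := (hs V le_top).2 n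
    refine ⟨∑ i, (powerι (structureSheaf X) i).app V (show Γ(structureSheaf X, V) from c i), ?_⟩
    rw [map_sum]
    exact Finset.sum_congr rfl fun i _ => hφ i _

theorem isFrame_restrict (U : X.Opens) (s : ι → Γ(M, U.ι ''ᵁ ⊤)) :
    IsFrame (M.restrict U.ι) ⊤ s ↔ IsFrame M (U.ι ''ᵁ ⊤) s := by
  -- Sections of the restriction over `W` are sections over the image of `W`; only the two scalar
  -- actions have to be matched.
  have key : ∀ W : U.toScheme.Opens,
      (Function.Bijective fun c : ι → Γ(U.toScheme, W) =>
        ∑ i, c i • res (U := ⊤) (V := W) (M.restrict U.ι) le_top (s i)) ↔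
      Function.Bijective fun c : ι → Γ(X, U.ι ''ᵁ W) =>
        ∑ i, c i • res M (Scheme.Hom.image_mono U.ι le_top : U.ι ''ᵁ W ≤ U.ι ''ᵁ ⊤) (s i) := by
    intro W
    have h : ∀ c : Γ(U.toScheme, W), ∀ m : Γ(M.restrict U.ι, W),
        c • m = (show Γ(M, U.ι ''ᵁ W) from (show Γ(X, U.ι ''ᵁ W) from c) •
          (show Γ(M, U.ι ''ᵁ W) from m)) := by
      intro c m
      have := Scheme.Modules.smul_restrictAppIso_hom_apply U.ι M W c m
      rw [Scheme.Opens.ι_appIso] at this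
      exact this
    simp only [h]
    rfl
  constructor
  · intro h V hV
    obtain ⟨W, rfl⟩ : ∃ W, U.ι ''ᵁ W = V := by
      refine ⟨U.ι ⁻¹ᵁ V, ?_⟩
      rw [Scheme.Hom.image_preimage_eq_opensRange_inf]
      rw [Scheme.Hom.image_top_eq_opensRange] at hV
      exact inf_eq_right.2 hV
    exact (key W).1 (h W le_top)
  · intro h W hW
    exact (key W).2 (h _ _)

/-- This replaces trivializations on open subschemes by sections of `M` on `X` itself, the form in
which bases can be extended, lifted and glued. -/
theorem isVectorBundle_iff_exists_isFrame : IsVectorBundle M ↔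
    ∀ x : X, ∃ (U : X.Opens) (_ : x ∈ U) (r : ℕ) (s : Fin r → Γ(M, U)), IsFrame M U s := by
  constructor
  · intro h x
    obtain ⟨U, r, hx, ⟨e⟩⟩ := h x
    have h1 := ((isFrame_structureSheaf (X := U.toScheme) (U := ⊤)).pow r).of_iso e.symm
    have h2 := (isFrame_restrict U _).1 (h1.reindex (Fintype.equivFin (Fin r × Unit)).symm)
    refine ⟨_, ?_, _, _, h2⟩
    rw [Scheme.Hom.image_top_eq_opensRange, Scheme.Opens.opensRange_ι]
    exact hx
  · intro h x
    obtain ⟨U, hx, r, s, hs⟩ := h x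
    have hU : U.ι ''ᵁ ⊤ ≤ U := by
      rw [Scheme.Hom.image_top_eq_opensRange, Scheme.Opens.opensRange_ι]
    exact ⟨U, r, hx, ((isFrame_restrict U _).2 (hs.of_le hU)).nonempty_iso⟩

theorem IsFrame.exists_fin {s : ι → Γ(M, U)} (hs : IsFrame M U s) :
    ∃ (r : ℕ) (s : Fin r → Γ(M, U)), IsFrame M U s :=
  ⟨_, _, hs.reindex (Fintype.equivFin ι).symm⟩

theorem IsVectorBundle.pow (hM : IsVectorBundle M) (a : ℕ) :
    IsVectorBundle (power M a) := by
  rw [isVectorBundle_iff_exists_isFrame] at hM ⊢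
  intro x
  obtain ⟨U, hx, r, s, hs⟩ := hM x
  exact ⟨U, hx, (hs.pow a).exists_fin⟩

theorem IsLocallyFreeOfRank.isVectorBundle {r : ℕ} (hM : IsLocallyFreeOfRank M r) :
    IsVectorBundle M := fun x => by
  obtain ⟨U, hx, h⟩ := hM x
  exact ⟨U, r, hx, h⟩

end Frames

/-! ### Values of sections in fibers, and frames from fiber bases. -/

section FiberValues

variable {X : Scheme.{u}}

theorem exists_common_open {ι : Type*} [Finite ι] {x : X} (V : ι → X.Opens) (h : ∀ i, x ∈ V i)
    {U : X.Opens} (hx : x ∈ U) : ∃ W ≤ U, x ∈ W ∧ ∀ i, W ≤ V i :=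
  ⟨⟨U ∩ ⋂ i, V i, U.2.inter (isOpen_iInter_of_finite fun i => (V i).2)⟩, fun _ hy => hy.1,
    ⟨hx, Set.mem_iInter.2 h⟩, fun i _ hy => Set.mem_iInter.1 hy.2 i⟩

/-- The value at `x` of a function near `x`. -/
def evalAt {U : X.Opens} {x : X} (hx : x ∈ U) :
    Γ(X, U) →+* IsLocalRing.ResidueField (X.presheaf.stalk x) :=
  (IsLocalRing.residue (X.presheaf.stalk x)).comp (X.presheaf.germ U x hx).hom

theorem evalAt_fres {U V : X.Opens} {x : X} (h : V ≤ U) (hx : x ∈ V) (r : Γ(X, U)) :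
    evalAt hx (fres h r) = evalAt (h hx) r :=
  congrArg (IsLocalRing.residue (X.presheaf.stalk x)) (germ_fres h x hx r)

theorem isUnit_germ_iff {U : X.Opens} {x : X} (hx : x ∈ U) (r : Γ(X, U)) :
    IsUnit (X.presheaf.germ U x hx r) ↔ evalAt hx r ≠ 0 :=
  (IsLocalRing.residue_ne_zero_iff_isUnit _).symm

/-- The value in the fiber at `x` of a section near `x`. -/
def valueAt (M : X.Modules) {U : X.Opens} {x : X} (hx : x ∈ U) : Γ(M, U) →+ Fiber M x :=
  ((TensorProduct.mk (X.presheaf.stalk x) (IsLocalRing.ResidueField (X.presheaf.stalk x))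
    (M.presheaf.stalk x) 1).toAddMonoidHom).comp (M.presheaf.germ U x hx).hom

variable {M N : X.Modules}

theorem valueAt_smul {U : X.Opens} {x : X} (hx : x ∈ U) (r : Γ(X, U)) (m : Γ(M, U)) :
    valueAt M hx (r • m) = evalAt hx r • valueAt M hx m := by
  change (1 : IsLocalRing.ResidueField (X.presheaf.stalk x)) ⊗ₜ[X.presheaf.stalk x]
      M.presheaf.germ U x hx (r • m) =
    (IsLocalRing.residue (X.presheaf.stalk x) (X.presheaf.germ U x hx r) •
      (1 : IsLocalRing.ResidueField (X.presheaf.stalk x))) ⊗ₜ[X.presheaf.stalk x] _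
  rw [germ_smul, ← TensorProduct.smul_tmul]
  congr 1

theorem valueAt_res {U V : X.Opens} {x : X} (h : V ≤ U) (hx : x ∈ V) (m : Γ(M, U)) :
    valueAt M hx (res M h m) = valueAt M (h hx) m :=
  congrArg (fun z => (1 : IsLocalRing.ResidueField (X.presheaf.stalk x))
    ⊗ₜ[X.presheaf.stalk x] z) (germ_res M h x hx m)

/-- The map induced on fibers, linear over the residue field. -/
def fiberLin (φ : M ⟶ N) (x : X) :
    Fiber M x →ₗ[IsLocalRing.ResidueField (X.presheaf.stalk x)] Fiber N x :=
  (stalkMap φ x).baseChange (IsLocalRing.ResidueField (X.presheaf.stalk x))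

theorem fiberLin_valueAt (φ : M ⟶ N) {U : X.Opens} {x : X} (hx : x ∈ U) (m : Γ(M, U)) :
    fiberLin φ x (valueAt M hx m) = valueAt N hx (φ.app U m) := by
  change (1 : IsLocalRing.ResidueField (X.presheaf.stalk x)) ⊗ₜ[X.presheaf.stalk x] _ =
    (1 : IsLocalRing.ResidueField (X.presheaf.stalk x)) ⊗ₜ[X.presheaf.stalk x] _
  congr 1
  exact TopCat.Presheaf.stalkFunctor_map_germ_apply (C := Ab) U x hx φ.mapPresheaf m

theorem exists_evalAt_eq {x : X} (c : IsLocalRing.ResidueField (X.presheaf.stalk x)) :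
    ∃ (U : X.Opens) (hx : x ∈ U) (r : Γ(X, U)), evalAt hx r = c := by
  obtain ⟨c, rfl⟩ := IsLocalRing.residue_surjective c
  obtain ⟨U, hx, r, rfl⟩ := TopCat.Presheaf.exists_germ_eq _ c
  exact ⟨U, hx, r, rfl⟩

theorem exists_valueAt_eq {x : X} (v : Fiber M x) :
    ∃ (U : X.Opens) (hx : x ∈ U) (m : Γ(M, U)), valueAt M hx m = v := by
  induction v using TensorProduct.induction_on with
  | zero => exact ⟨⊤, trivial, 0, map_zero _⟩
  | tmul c y =>
    obtain ⟨U, hx, r, rfl⟩ := exists_evalAt_eq c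
    obtain ⟨V, hxV, m, rfl⟩ := TopCat.Presheaf.exists_germ_eq _ y
    have hUV : x ∈ U ⊓ V := ⟨hx, hxV⟩
    refine ⟨U ⊓ V, hUV, (fres inf_le_left r : Γ(X, U ⊓ V)) • (res M inf_le_right m : Γ(M, U ⊓ V)),
      ?_⟩
    rw [valueAt_smul, valueAt_res, evalAt_fres]
    refine (TensorProduct.smul_tmul' _ _ _).trans ?_
    rw [smul_eq_mul, mul_one]
  | add v w hv hw =>
    obtain ⟨U, hx, m, rfl⟩ := hv
    obtain ⟨V, hxV, m', rfl⟩ := hw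
    have hUV : x ∈ U ⊓ V := ⟨hx, hxV⟩
    refine ⟨U ⊓ V, hUV, res M inf_le_left m + res M inf_le_right m', ?_⟩
    rw [map_add, valueAt_res, valueAt_res]
    rfl

theorem exists_valueAt_eq_of_finite {ι : Type*} [Finite ι] {U : X.Opens} {x : X} (hx : x ∈ U)
    (v : ι → Fiber M x) : ∃ (V : X.Opens) (_ : V ≤ U) (hxV : x ∈ V) (m : ι → Γ(M, V)),
      ∀ i, valueAt M hxV (m i) = v i := by
  choose V hxV m hm using fun i => exists_valueAt_eq (v i)
  obtain ⟨W, hWU, hxW, hW⟩ := exists_common_open V hxV hx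
  exact ⟨W, hWU, hxW, fun i => res M (hW i) (m i), fun i => (valueAt_res _ _ _).trans (hm i)⟩

variable {ι : Type*} [Fintype ι]

/-- A frame induces a basis of the stalk. -/
theorem IsFrame.exists_stalkBasis {U : X.Opens} {s : ι → Γ(M, U)} (hs : IsFrame M U s) {x : X}
    (hx : x ∈ U) : ∃ b : Module.Basis ι (X.presheaf.stalk x) (M.presheaf.stalk x),
      ∀ i, b i = M.presheaf.germ U x hx (s i) := by
  have hli : LinearIndependent (X.presheaf.stalk x) fun i => M.presheaf.germ U x hx (s i) := by
    rw [Fintype.linearIndependent_iff]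
    intro c hc
    choose V hxV r hr using fun i => TopCat.Presheaf.exists_germ_eq _ (c i)
    obtain ⟨W, hWU, hxW, hW⟩ := exists_common_open V hxV hx
    have h0 : M.presheaf.germ W x hxW (∑ i, fres (hW i) (r i) • res M hWU (s i)) =
        M.presheaf.germ W x hxW 0 := by
      rw [map_sum, map_zero, ← hc]
      refine Finset.sum_congr rfl fun i _ => ?_
      rw [germ_smul, germ_res, germ_fres, hr]
    -- A relation between germs already holds between sections on a neighborhood, where the frame
    -- property kills its coefficients.
    obtain ⟨W', hW', hxW', e⟩ := exists_res_eq_of_germ_eq hxW h0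
    have h1 := @(hs W' (hW'.trans hWU)).1 (fun i => fres (hW'.trans (hW i)) (r i)) 0 (by
      simpa only [res_sum_smul, res_res, fres_fres, map_zero, Pi.zero_apply, zero_smul,
        Finset.sum_const_zero] using e)
    intro i
    rw [← hr, ← germ_fres (hW'.trans (hW i)) x hxW', congrFun h1 i]
    exact map_zero _
  have hsp : ⊤ ≤ Submodule.span (X.presheaf.stalk x)
      (Set.range fun i => M.presheaf.germ U x hx (s i)) := by
    intro y _
    obtain ⟨V, hxV, m, rfl⟩ := TopCat.Presheaf.exists_germ_eq _ y
    have hVU : x ∈ V ⊓ U := ⟨hxV, hx⟩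
    obtain ⟨c, hc⟩ := (hs (V ⊓ U) inf_le_right).2 (res M inf_le_left m)
    have h1 := congrArg (M.presheaf.germ (V ⊓ U) x hVU) hc
    rw [germ_res, map_sum] at h1
    rw [← h1]
    refine Submodule.sum_mem _ fun i _ => ?_
    rw [germ_smul, germ_res]
    exact Submodule.smul_mem _ _ (Submodule.subset_span ⟨i, rfl⟩)
  exact ⟨Module.Basis.mk hli hsp, fun i => Module.Basis.mk_apply hli hsp i⟩

/-- A frame induces a basis of the fiber. -/
theorem IsFrame.exists_fiberBasis {U : X.Opens} {s : ι → Γ(M, U)} (hs : IsFrame M U s) {x : X}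
    (hx : x ∈ U) :
    ∃ b : Module.Basis ι (IsLocalRing.ResidueField (X.presheaf.stalk x)) (Fiber M x),
      ∀ i, b i = valueAt M hx (s i) := by
  obtain ⟨b, hb⟩ := hs.exists_stalkBasis hx
  refine ⟨b.baseChange _, fun i => ?_⟩
  refine (Module.Basis.baseChange_apply _ b i).trans ?_
  rw [hb]
  rfl

/-- An invertible change of frame. -/
theorem IsFrame.of_isUnit_det [DecidableEq ι] {U : X.Opens} {s t : ι → Γ(M, U)}
    (hs : IsFrame M U s) (A : Matrix ι ι Γ(X, U)) (hA : IsUnit A.det)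
    (ht : ∀ i, t i = ∑ j, A j i • s j) : IsFrame M U t := by
  intro V h
  let B := A.map (fres h)
  have hB : IsUnit B := (Matrix.isUnit_iff_isUnit_det _).2 (by
    have := hA.map (fres h)
    rwa [RingHom.map_det] at this)
  have hbij : Function.Bijective fun c : ι → Γ(X, V) => B.mulVec c := by
    obtain ⟨B', hB'⟩ := hB.exists_left_inv
    obtain ⟨B'', hB''⟩ := hB.exists_right_inv
    refine ⟨Function.LeftInverse.injective (g := fun c => B'.mulVec c) fun c => ?_,
      Function.RightInverse.surjective (g := fun c => B''.mulVec c) fun c => ?_⟩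
    · simp [Matrix.mulVec_mulVec, hB']
    · simp [Matrix.mulVec_mulVec, hB'']
  convert (hs V h).comp hbij using 2 with c
  simp only [ht, Function.comp, Matrix.mulVec, dotProduct, res_sum_smul, Finset.smul_sum,
    Finset.sum_smul, smul_smul]
  rw [Finset.sum_comm]
  refine Finset.sum_congr rfl fun i _ => Finset.sum_congr rfl fun j _ => ?_
  rw [mul_comm]
  rfl

/-- Sections of a vector bundle whose values at `x` form a basis are a frame near `x`. -/
theorem exists_isFrame_of_basis {ι' : Type*} [Fintype ι'] {U : X.Opens} {s : ι → Γ(M, U)}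
    (hs : IsFrame M U s) {x : X} (hx : x ∈ U) (t : ι' → Γ(M, U))
    (b : Module.Basis ι' (IsLocalRing.ResidueField (X.presheaf.stalk x)) (Fiber M x))
    (hb : ∀ i, b i = valueAt M hx (t i)) :
    ∃ (V : X.Opens) (hV : V ≤ U), x ∈ V ∧ IsFrame M V fun i => res M hV (t i) := by
  classical
  obtain ⟨b₀, hb₀⟩ := hs.exists_fiberBasis hx
  -- Two bases of one fiber have equivalent index types; after reindexing, the change of frame is a
  -- square matrix.
  let e : ι' ≃ ι := b.indexEquiv b₀
  suffices ∃ (V : X.Opens) (hV : V ≤ U), x ∈ V ∧ IsFrame M V fun i => res M hV (t (e.symm i)) by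
    obtain ⟨V, hV, hxV, h⟩ := this
    refine ⟨V, hV, hxV, ?_⟩
    simpa [Function.comp_def] using h.reindex e
  choose A hA using fun i => (hs U le_rfl).2 (t (e.symm i))
  simp only [res_refl] at hA
  let B : Matrix ι ι Γ(X, U) := Matrix.of fun j i => A i j
  -- At `x` the matrix `B` becomes a base change matrix between two bases of the fiber. Its
  -- determinant is therefore nonzero at `x`, and a unit on its basic open set.
  have hB : evalAt hx B.det ≠ 0 := by
    rw [RingHom.map_det]
    have : (evalAt hx).mapMatrix B = b₀.toMatrix (b.reindex e) := by
      ext j i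
      have h1 : (b.reindex e) i = ∑ j, evalAt hx (A i j) • b₀ j := by
        rw [Module.Basis.reindex_apply, hb, ← hA, map_sum]
        refine Finset.sum_congr rfl fun k _ => ?_
        rw [valueAt_smul, hb₀]
      rw [Module.Basis.toMatrix_apply, h1, b₀.repr_sum_self]
      rfl
    rw [this]
    have h2 := congrArg Matrix.det (b₀.toMatrix_mul_toMatrix_flip (b.reindex e))
    rw [Matrix.det_mul, Matrix.det_one] at h2
    exact left_ne_zero_of_mul_eq_one h2
  rw [← isUnit_germ_iff, ← Scheme.mem_basicOpen] at hB
  refine ⟨X.basicOpen B.det, X.basicOpen_le _, hB, ?_⟩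
  refine (hs.of_le (X.basicOpen_le B.det)).of_isUnit_det ((fres (X.basicOpen_le B.det)).mapMatrix B)
    ?_ fun i => ?_
  · rw [← RingHom.map_det]
    exact RingedSpace.isUnit_res_basicOpen _ _
  · rw [← hA, res_sum_smul]
    rfl

end FiberValues

/-! ### Frames in short exact sequences. -/

section ShortExactSequences

variable {X : Scheme.{u}} {ι ι' : Type*}

theorem res_sum_elim {M : X.Modules} {U V : X.Opens} (h : V ≤ U) (s : ι → Γ(M, U))
    (t : ι' → Γ(M, U)) :
    (fun p => res M h (Sum.elim s t p)) =
      Sum.elim (fun i => res M h (s i)) (fun i => res M h (t i)) := by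
  funext p
  cases p <;> rfl

variable [Fintype ι] [Fintype ι']

theorem sum_elim_smul {A B : Type*} [Semiring A] [AddCommMonoid B] [Module A B]
    (c : ι ⊕ ι' → A) (s : ι → B) (t : ι' → B) :
    ∑ p, c p • Sum.elim s t p = ∑ i, c (.inl i) • s i + ∑ i, c (.inr i) • t i := by
  simp [Fintype.sum_sum_type]

/-- In a short exact sequence, the image of a complement of a frame is a frame. -/
theorem IsFrame.of_sum_elim {S : ShortComplex X.Modules} (hS : S.ShortExact) {U : X.Opens}
    {s : ι → Γ(S.X₁, U)} (hs : IsFrame S.X₁ U s) {n : ι' → Γ(S.X₂, U)}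
    (hn : IsFrame S.X₂ U (Sum.elim (fun i => S.f.app U (s i)) n)) :
    IsFrame S.X₃ U fun i => S.g.app U (n i) := by
  have := hS.mono_f
  have := hS.epi_g
  have hfg : ∀ (V : X.Opens) (m : Γ(S.X₁, V)), S.g.app V (S.f.app V m) = 0 := fun V m =>
    congrArg (fun φ : S.X₁ ⟶ S.X₃ => φ.app V m) S.zero
  have hinj : ∀ (V : X.Opens) (h : V ≤ U), Function.Injective
      fun c : ι' → Γ(X, V) => ∑ i, c i • res S.X₃ h (S.g.app U (n i)) := by
    intro V h c c' hc
    have h0 : S.g.app V (∑ i, (c - c') i • res S.X₂ h (n i)) = 0 := by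
      rw [app_sum_smul]
      simp only [app_res, Pi.sub_apply, sub_smul, Finset.sum_sub_distrib]
      exact sub_eq_zero.2 hc
    obtain ⟨m, hm⟩ := exists_app_eq hS.exact V _ h0
    obtain ⟨a, rfl⟩ := (hs V h).2 m
    -- One section of `S.X₂` has two expansions in the frame, one through the image of `S.f` and one
    -- through the complement; uniqueness makes both zero.
    have h1 := @(hn V h).1 (Sum.elim a 0) (Sum.elim 0 (c - c')) (by
      have e := res_sum_elim h (fun i => S.f.app U (s i)) n
      have e' : ∀ p, res S.X₂ h (Sum.elim (fun i => S.f.app U (s i)) n p) = _ := congrFun e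
      simp only [e', sum_elim_smul, Sum.elim_inl, Sum.elim_inr, Pi.zero_apply, zero_smul,
        Finset.sum_const_zero, add_zero, zero_add, ← hm, app_sum_smul, app_res])
    funext i
    exact (sub_eq_zero.1 (congrFun h1 (.inr i)).symm)
  have hloc : ∀ (V : X.Opens) (h : V ≤ U) (y : Γ(S.X₃, V)), ∀ x ∈ V, ∃ (W : X.Opens) (hW : W ≤ V)
      (_ : x ∈ W) (c : ι' → Γ(X, W)),
        ∑ i, c i • res S.X₃ (hW.trans h) (S.g.app U (n i)) = res S.X₃ hW y := by
    intro V h y x hx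
    obtain ⟨W, hW, hxW, m, hm⟩ := exists_app_eq_res S.g V y x hx
    obtain ⟨a, rfl⟩ := (hn W (hW.trans h)).2 m
    refine ⟨W, hW, hxW, fun i => a (.inr i), ?_⟩
    have e := res_sum_elim (hW.trans h) (fun i => S.f.app U (s i)) n
    have e' : ∀ p, res S.X₂ (hW.trans h) (Sum.elim (fun i => S.f.app U (s i)) n p) = _ :=
      congrFun e
    simp only [e', sum_elim_smul] at hm
    rw [← hm, map_add, app_sum_smul, app_sum_smul]
    simp only [app_res, hfg, map_zero, smul_zero, Finset.sum_const_zero, zero_add]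
  have hcres : ∀ (V W W' : X.Opens) (h : V ≤ U) (hW : W ≤ V) (hW' : W' ≤ W) (y : Γ(S.X₃, V))
      (c : ι' → Γ(X, W)),
      ∑ i, c i • res S.X₃ (hW.trans h) (S.g.app U (n i)) = res S.X₃ hW y →
      ∑ i, fres hW' (c i) • res S.X₃ ((hW'.trans hW).trans h) (S.g.app U (n i)) =
        res S.X₃ (hW'.trans hW) y := by
    intro V W W' h hW hW' y c hc
    have := congrArg (res S.X₃ hW') hc
    simpa only [res_sum_smul, res_res] using this
  intro V h
  refine ⟨hinj V h, fun y => ?_⟩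
  -- A section of `S.X₃` lifts only locally, so its coefficients exist only locally. Each coordinate
  -- `l` is glued separately, with `hinj` giving the uniqueness needed on overlaps.
  have hr := fun l : ι' => exists_function_of_local (U := V)
    (fun W hW r => ∃ c : ι' → Γ(X, W), c l = r ∧
      ∑ i, c i • res S.X₃ (hW.trans h) (S.g.app U (n i)) = res S.X₃ hW y)
    (by
      rintro W W' hW hW' r ⟨c, rfl, hc⟩
      exact ⟨fun i => fres hW' (c i), rfl, hcres _ _ _ h hW hW' y c hc⟩)
    (by
      rintro W hW r r' ⟨c, rfl, hc⟩ ⟨c', rfl, hc'⟩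
      exact congrFun (hinj W (hW.trans h) (hc.trans hc'.symm)) l)
    (by
      intro x hx
      obtain ⟨W, hW, hxW, c, hc⟩ := hloc V h y x hx
      exact ⟨W, hW, hxW, c l, c, rfl, hc⟩)
  choose r hr using hr
  refine ⟨r, section_ext fun x hx => ?_⟩
  obtain ⟨W, hW, hxW, c, hc⟩ := hloc V h y x hx
  -- The glued coordinates come from possibly different local expansions `d l`; on a common smaller
  -- open set each must agree with the single expansion `c`.
  choose T hT hxT d hd hd' using fun l => hr l x hx
  obtain ⟨W', hW'W, hxW', hW'T⟩ := exists_common_open T hxT hxW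
  refine ⟨W', hW'W.trans hW, hxW', ?_⟩
  rw [← hcres _ _ _ h hW hW'W y c hc]
  simp only [res_sum_smul, res_res]
  refine Finset.sum_congr rfl fun l _ => ?_
  congr 1
  have h1 := hcres _ _ _ h (hT l) (hW'T l) y _ (hd' l)
  have h2 := congrFun (hinj W' _ (h1.trans (hcres _ _ _ h hW hW'W y c hc).symm)) l
  rw [← h2, hd l, fres_fres]

/-- In a short exact sequence, a frame of the kernel and lifts of a frame of the cokernel form a
frame. -/
theorem IsFrame.sum_elim {S : ShortComplex X.Modules} (hS : S.ShortExact) {U : X.Opens}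
    {s : ι → Γ(S.X₁, U)} (hs : IsFrame S.X₁ U s) {n : ι' → Γ(S.X₂, U)}
    (hn : IsFrame S.X₃ U fun i => S.g.app U (n i)) :
    IsFrame S.X₂ U (Sum.elim (fun i => S.f.app U (s i)) n) := by
  have := hS.mono_f
  have hfg : ∀ (V : X.Opens) (m : Γ(S.X₁, V)), S.g.app V (S.f.app V m) = 0 := fun V m =>
    congrArg (fun φ : S.X₁ ⟶ S.X₃ => φ.app V m) S.zero
  intro V h
  have e := res_sum_elim h (fun i => S.f.app U (s i)) n
  have e' : ∀ p, res S.X₂ h (Sum.elim (fun i => S.f.app U (s i)) n p) = _ := congrFun e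
  constructor
  · intro c c' hc
    simp only [e', sum_elim_smul] at hc
    have h1 := congrArg (S.g.app V) hc
    simp only [map_add, app_sum_smul, app_res, hfg, map_zero, smul_zero, Finset.sum_const_zero,
      zero_add] at h1
    have h2 := @(hn V h).1 (fun i => c (.inr i)) (fun i => c' (.inr i)) h1
    have h2' := fun i => congrFun h2 i
    simp only [h2', add_left_inj] at hc
    have h3 := @(hs V h).1 (fun i => c (.inl i)) (fun i => c' (.inl i)) (app_injective S.f V (by
      simpa only [app_sum_smul, app_res] using hc))
    funext p
    cases p with
    | inl i => exact congrFun h3 i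
    | inr i => exact h2' i
  · intro m
    obtain ⟨b, hb⟩ := (hn V h).2 (S.g.app V m)
    obtain ⟨k, hk⟩ := exists_app_eq hS.exact V (m - ∑ i, b i • res S.X₂ h (n i)) (by
      rw [map_sub, app_sum_smul, sub_eq_zero]
      simp only [app_res]
      exact hb.symm)
    obtain ⟨a, rfl⟩ := (hs V h).2 k
    refine ⟨Sum.elim a b, ?_⟩
    simp only [e', sum_elim_smul, Sum.elim_inl, Sum.elim_inr]
    rw [app_sum_smul] at hk
    simp only [app_res] at hk
    rw [hk, sub_add_cancel]

end ShortExactSequences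

/-! ### Fiberwise injectivity and locally free cokernels. -/

section FiberwiseInjective

variable {X : Scheme.{u}} {G H : X.Modules}

theorem exists_basis_sum_elim {K V : Type*} [Field K] [AddCommGroup V] [Module K V]
    [FiniteDimensional K V] {ι : Type*} {v : ι → V} (hv : LinearIndependent K v) :
    ∃ (k : ℕ) (w : Fin k → V) (b : Module.Basis (ι ⊕ Fin k) K V), ⇑b = Sum.elim v w := by
  obtain ⟨C, hC⟩ := Submodule.exists_isCompl (Submodule.span K (Set.range v))
  let b := ((Module.Basis.span hv).prod (Module.finBasis K C)).map
    (Submodule.prodEquivOfIsCompl _ _ hC)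
  refine ⟨_, fun i => (Module.finBasis K C i : V), b, ?_⟩
  funext p
  cases p <;> simp [b, Module.Basis.span_apply]

/-- Near a point at which `φ` is injective on fibers, the image of a frame extends to a frame. -/
theorem exists_isFrame_sum_elim (hG : IsVectorBundle G) (hH : IsVectorBundle H) (φ : G ⟶ H) (x : X)
    (hφ : Function.Injective (fiberLin φ x)) :
    ∃ (V : X.Opens) (_ : x ∈ V) (m k : ℕ) (s : Fin m → Γ(G, V)) (n : Fin k → Γ(H, V)),
      IsFrame G V s ∧ IsFrame H V (Sum.elim (fun i => φ.app V (s i)) n) := by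
  rw [isVectorBundle_iff_exists_isFrame] at hG hH
  obtain ⟨U, hxU, m, s, hs⟩ := hG x
  obtain ⟨U', hxU', m', t, ht⟩ := hH x
  have hxI : x ∈ U ⊓ U' := ⟨hxU, hxU'⟩
  obtain ⟨b, hb⟩ := hs.exists_fiberBasis hxU
  obtain ⟨b', hb'⟩ := ht.exists_fiberBasis hxU'
  have := Module.Finite.of_basis b'
  -- The independent image of a fiber basis is completed to a basis of the fiber of `H`; the added
  -- vectors `w` are then lifted to sections `n`.
  have hli : LinearIndependent (IsLocalRing.ResidueField (X.presheaf.stalk x)) (fiberLin φ x ∘ b) :=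
    b.linearIndependent.map' _ (LinearMap.ker_eq_bot.2 hφ)
  obtain ⟨k, w, c, hc⟩ := exists_basis_sum_elim hli
  obtain ⟨V, hV, hxV, n, hn⟩ := exists_valueAt_eq_of_finite hxI w
  have hVU := hV.trans inf_le_left
  obtain ⟨W, hW, hxW, hf⟩ := exists_isFrame_of_basis (ht.of_le (hV.trans inf_le_right)) hxV
    (Sum.elim (fun i => φ.app V (res G hVU (s i))) n) c (by
      intro p
      rw [hc]
      cases p with
      | inl i =>
        rw [Sum.elim_inl, Sum.elim_inl, ← fiberLin_valueAt, valueAt_res, ← hb]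
        rfl
      | inr i => exact (hn i).symm)
  refine ⟨W, hxW, m, k, fun i => res G (hW.trans hVU) (s i), fun i => res H hW (n i),
    hs.of_le _, ?_⟩
  rw [res_sum_elim] at hf
  simpa only [← app_res, res_res] using hf

/-- In a Jacobson space the closure of `y` contains a closed point. Any open set around that point
contains `y`, which is why conditions at closed points control all of `X`. -/
theorem exists_isClosed_specializes [JacobsonSpace X] (y : X) :
    ∃ x : X, IsClosed ({x} : Set X) ∧ y ⤳ x := by
  obtain ⟨x, hx, hx'⟩ := nonempty_inter_closedPoints (Z := closure ({y} : Set X))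
    ⟨y, subset_closure rfl⟩ isClosed_closure.isLocallyClosed
  exact ⟨x, hx', specializes_iff_mem_closure.2 hx⟩

/-- A map of vector bundles which is injective on the fibers at closed points is a monomorphism
and its cokernel is a vector bundle. -/
theorem mono_and_isVectorBundle_cokernel [JacobsonSpace X] (hG : IsVectorBundle G)
    (hH : IsVectorBundle H) (φ : G ⟶ H)
    (hφ : ∀ x : X, IsClosed ({x} : Set X) → Function.Injective (fiberLin φ x)) :
    Mono φ ∧ IsVectorBundle (cokernel φ) := by
  have hloc : ∀ y : X, ∃ (V : X.Opens) (_ : y ∈ V) (m k : ℕ) (s : Fin m → Γ(G, V))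
      (n : Fin k → Γ(H, V)), IsFrame G V s ∧ IsFrame H V (Sum.elim (fun i => φ.app V (s i)) n) := by
    intro y
    obtain ⟨x, hx, hyx⟩ := exists_isClosed_specializes y
    obtain ⟨V, hxV, h⟩ := exists_isFrame_sum_elim hG hH φ x (hφ x hx)
    exact ⟨V, hyx.mem_open V.2 hxV, h⟩
  have hmono : Mono φ := by
    refine mono_of_app_injective φ fun U => (injective_iff_map_eq_zero _).2 fun m hm => ?_
    refine section_ext fun x hx => ?_
    obtain ⟨V, hxV, _, _, s, n, hs, hn⟩ := hloc x
    have hxI : x ∈ U ⊓ V := ⟨hx, hxV⟩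
    refine ⟨U ⊓ V, inf_le_left, hxI, ?_⟩
    obtain ⟨a, ha⟩ := (hs (U ⊓ V) inf_le_right).2 (res G inf_le_left m)
    have h0 : φ.app _ (res G (inf_le_left : U ⊓ V ≤ U) m) = 0 := by
      rw [app_res, hm, map_zero]
    have e := res_sum_elim (inf_le_right : U ⊓ V ≤ V) (fun i => φ.app V (s i)) n
    have e' : ∀ p, res H (inf_le_right : U ⊓ V ≤ V) (Sum.elim (fun i => φ.app V (s i)) n p) = _ :=
      congrFun e
    have h1 := @(hn (U ⊓ V) inf_le_right).1 (Sum.elim a 0) 0 (by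
      rw [← ha, app_sum_smul] at h0
      simpa only [e', sum_elim_smul, Sum.elim_inl, Sum.elim_inr, Pi.zero_apply, zero_smul,
        Finset.sum_const_zero, add_zero, app_res] using h0)
    have h2 : a = 0 := funext fun i => congrFun h1 (.inl i)
    rw [map_zero, ← ha, h2]
    simp
  refine ⟨hmono, isVectorBundle_iff_exists_isFrame.2 fun x => ?_⟩
  obtain ⟨V, hxV, _, _, s, n, hs, hn⟩ := hloc x
  have hS : (ShortComplex.mk φ (cokernel.π φ) (cokernel.condition φ)).ShortExact :=
    { exact := ShortComplex.exact_cokernel φ }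
  exact ⟨V, hxV, _, _, hs.of_sum_elim hS hn⟩

/-- If the cokernel in a short exact sequence of vector bundles is a vector bundle, then the
first map is injective on fibers. -/
theorem fiberLin_injective_of_shortExact {S : ShortComplex X.Modules} (hS : S.ShortExact)
    (h₁ : IsVectorBundle S.X₁) (h₃ : IsVectorBundle S.X₃) (x : X) :
    Function.Injective (fiberLin S.f x) := by
  rw [isVectorBundle_iff_exists_isFrame] at h₁ h₃
  have := hS.epi_g
  obtain ⟨U, hxU, m, s, hs⟩ := h₁ x
  obtain ⟨U', hxU', k, t, ht⟩ := h₃ x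
  choose V hV hxV n hn using fun i => exists_app_eq_res S.g U' (t i) x hxU'
  have hxI : x ∈ U ⊓ U' := ⟨hxU, hxU'⟩
  obtain ⟨W, hW, hxW, hWV⟩ := exists_common_open V hxV hxI
  have hf := (hs.of_le (hW.trans inf_le_left)).sum_elim hS (n := fun i => res S.X₂ (hWV i) (n i)) (by
    simpa only [app_res, hn, res_res] using ht.of_le (hW.trans inf_le_right))
  obtain ⟨b, hb⟩ := (hs.of_le (hW.trans inf_le_left)).exists_fiberBasis hxW
  obtain ⟨c, hc⟩ := hf.exists_fiberBasis hxW
  have hli := c.linearIndependent.comp Sum.inl Sum.inl_injective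
  -- Thus `fiberLin S.f x` sends a basis to part of a basis, which forces its kernel to vanish.
  have e : c ∘ Sum.inl = fiberLin S.f x ∘ b := by
    funext i
    simp only [Function.comp, hb, hc, fiberLin_valueAt, Sum.elim_inl]
  rw [e] at hli
  refine LinearMap.ker_eq_bot.1 (LinearMap.ker_eq_bot'.2 fun v hv => ?_)
  rw [← b.sum_repr v, map_sum] at hv
  simp only [map_smul] at hv
  have h0 := Fintype.linearIndependent_iff.1 hli _ hv
  rw [← b.sum_repr v]
  simp [h0]

end FiberwiseInjective

/-! ### Matrix components of maps between `V ⊗ E` and `W ⊗ F`. -/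

section TensorComponents

variable (κ : Type u) [Field κ] {X : Scheme.{u}}

section

variable (V : Type u) [AddCommGroup V] [Module κ V] (E : X.Modules)

/-- The map `E ⟶ V ⊗ E` given by a basis vector of `V`. -/
def tensorι (j : Fin (Module.finrank κ V)) : E ⟶ tensorObj κ V E :=
  powerι E j

/-- The map `V ⊗ E ⟶ E` given by a coordinate on `V`. -/
def tensorπ (j : Fin (Module.finrank κ V)) : tensorObj κ V E ⟶ E :=
  powerπ E j

theorem tensorι_tensorπ (j k : Fin (Module.finrank κ V)) :
    tensorι κ V E j ≫ tensorπ κ V E k = if j = k then 𝟙 E else 0 :=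
  powerι_powerπ j k

theorem tensorπ_tensorι_total :
    ∑ j, tensorπ κ V E j ≫ tensorι κ V E j = 𝟙 (tensorObj κ V E) :=
  powerπ_powerι_total E _

end

variable {κ} in
theorem tensorObj_hom_ext {V W : Type u} [AddCommGroup V] [Module κ V]
    [AddCommGroup W] [Module κ W] {E F : X.Modules} {f g : tensorObj κ V E ⟶ tensorObj κ W F}
    (h : ∀ j k, tensorι κ V E j ≫ f ≫ tensorπ κ W F k = tensorι κ V E j ≫ g ≫ tensorπ κ W F k) :
    f = g :=
  power_hom_ext fun k => power_hom_ext' fun j => h j k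

end TensorComponents

/-! ### The fiber of `V ⊗ E` and global injectivity. -/

section FibersOfTensor

variable {κ : Type u} [Field κ] {X : Scheme.{u}} [X.Over (Spec (.of κ))]

/-- By definition `c • φ` is multiplication by the global function of `c` followed by `φ`; linearity
of `φ` moves the scalar to the target. -/
theorem smul_hom_app {M N : X.Modules} (c : κ) (φ : M ⟶ N) {U : X.Opens} (m : Γ(M, U)) :
    (c • φ).app U m = (fres le_top (scalarSection κ X c) : Γ(X, U)) • φ.app U m := by
  rw [← Scheme.Modules.Hom.app_smul]
  rfl

variable (κ)

theorem fiberMap_valueAt {M N : X.Modules} (φ : M ⟶ N) {U : X.Opens} {x : X} (hx : x ∈ U)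
    (m : Γ(M, U)) : fiberMap κ φ x (valueAt M hx m) = valueAt N hx (φ.app U m) :=
  fiberLin_valueAt φ hx m

theorem fiberMap_ext {M N : X.Modules} {x : X} {f g : Fiber M x →ₗ[κ] Fiber N x}
    (h : ∀ (U : X.Opens) (hx : x ∈ U) (m : Γ(M, U)), f (valueAt M hx m) = g (valueAt M hx m)) :
    f = g := by
  ext v
  obtain ⟨U, hx, m, rfl⟩ := exists_valueAt_eq v
  exact h U hx m

theorem fiberMap_id (M : X.Modules) (x : X) : fiberMap κ (𝟙 M) x = LinearMap.id :=
  fiberMap_ext κ fun _ hx m => fiberMap_valueAt κ _ hx m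

theorem fiberMap_comp {L M N : X.Modules} (φ : L ⟶ M) (ψ : M ⟶ N) (x : X) :
    fiberMap κ (φ ≫ ψ) x = fiberMap κ ψ x ∘ₗ fiberMap κ φ x :=
  fiberMap_ext κ fun U hx m => by
    rw [LinearMap.comp_apply, fiberMap_valueAt, fiberMap_valueAt, fiberMap_valueAt]
    rfl

theorem fiberMap_sum {M N : X.Modules} {ι : Type*} (t : Finset ι) (φ : ι → (M ⟶ N)) (x : X) :
    fiberMap κ (∑ i ∈ t, φ i) x = ∑ i ∈ t, fiberMap κ (φ i) x :=
  fiberMap_ext κ fun U hx m => by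
    rw [LinearMap.sum_apply, fiberMap_valueAt, sum_app, map_sum]
    simp only [fiberMap_valueAt]

theorem fiberMap_smul {M N : X.Modules} (c : κ) (φ : M ⟶ N) (x : X) :
    fiberMap κ (c • φ) x = c • fiberMap κ φ x :=
  fiberMap_ext κ fun U hx m => by
    rw [LinearMap.smul_apply, fiberMap_valueAt, fiberMap_valueAt, smul_hom_app, valueAt_smul,
      evalAt_fres]
    rfl

variable {κ}

theorem tensorι_tensorMap_tensorπ {V W : Type u} [AddCommGroup V] [Module κ V]
    [FiniteDimensional κ V] [AddCommGroup W] [Module κ W] [FiniteDimensional κ W] (A : V →ₗ[κ] W)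
    {E F : X.Modules} (σ : E ⟶ F) (j : Fin (Module.finrank κ V)) (k : Fin (Module.finrank κ W)) :
    tensorι κ V E j ≫ tensorMap A σ ≫ tensorπ κ W F k =
      LinearMap.toMatrix (Module.finBasis κ V) (Module.finBasis κ W) A k j • σ :=
  biproduct.matrix_components _ _ _

theorem tensorι_tensorMap {V W : Type u} [AddCommGroup V] [Module κ V] [FiniteDimensional κ V]
    [AddCommGroup W] [Module κ W] [FiniteDimensional κ W] (A : V →ₗ[κ] W) {E F : X.Modules}
    (σ : E ⟶ F) (j : Fin (Module.finrank κ V)) :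
    tensorι κ V E j ≫ tensorMap A σ = ∑ k,
      LinearMap.toMatrix (Module.finBasis κ V) (Module.finBasis κ W) A k j •
        (σ ≫ tensorι κ W F k) := by
  have h := congrArg (fun φ => tensorι κ V E j ≫ tensorMap A σ ≫ φ) (tensorπ_tensorι_total κ W F)
  simp only [Category.comp_id, Preadditive.comp_sum] at h
  rw [← h]
  refine Finset.sum_congr rfl fun k _ => ?_
  have h' := congrArg (· ≫ tensorι κ W F k) (tensorι_tensorMap_tensorπ A σ j k)
  simpa only [Category.assoc, Linear.smul_comp] using h'

variable (κ)

section

variable (V : Type u) [AddCommGroup V] [Module κ V] [FiniteDimensional κ V] (E : X.Modules) (x : X)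

/-- The comparison map `V ⊗ E(x) → (V ⊗ E)(x)`. -/
def tensorFiber : V ⊗[κ] Fiber E x →ₗ[κ] Fiber (tensorObj κ V E) x :=
  ∑ j, TensorProduct.lift
    (((Module.finBasis κ V).coord j).smulRight (fiberMap κ (tensorι κ V E j) x))

theorem tensorFiber_tmul (v : V) (y : Fiber E x) : tensorFiber κ V E x (v ⊗ₜ y) =
    ∑ j, (Module.finBasis κ V).repr v j • fiberMap κ (tensorι κ V E j) x y := by
  simp [tensorFiber]

theorem tensorFiber_basis_tmul (j : Fin (Module.finrank κ V)) (y : Fiber E x) :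
    tensorFiber κ V E x (Module.finBasis κ V j ⊗ₜ y) = fiberMap κ (tensorι κ V E j) x y := by
  rw [tensorFiber_tmul, Finset.sum_eq_single j]
  · simp
  · intro k _ hk
    simp [Ne.symm hk]
  · simp

/-- The inverse of `tensorFiber`. -/
def tensorFiberInv : Fiber (tensorObj κ V E) x →ₗ[κ] V ⊗[κ] Fiber E x :=
  ∑ j, TensorProduct.mk κ V (Fiber E x) (Module.finBasis κ V j) ∘ₗ fiberMap κ (tensorπ κ V E j) x

theorem tensorFiber_bijective : Function.Bijective (tensorFiber κ V E x) := by
  have h1 : tensorFiberInv κ V E x ∘ₗ tensorFiber κ V E x = LinearMap.id := by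
    refine TensorProduct.ext ((Module.finBasis κ V).ext fun j => LinearMap.ext fun y => ?_)
    change tensorFiberInv κ V E x (tensorFiber κ V E x (Module.finBasis κ V j ⊗ₜ y)) =
      Module.finBasis κ V j ⊗ₜ y
    rw [tensorFiber_basis_tmul]
    simp only [tensorFiberInv, LinearMap.sum_apply, LinearMap.comp_apply]
    have h : ∀ k, fiberMap κ (tensorπ κ V E k) x (fiberMap κ (tensorι κ V E j) x y) =
        if j = k then y else 0 := by
      intro k
      rw [← LinearMap.comp_apply, ← fiberMap_comp, tensorι_tensorπ]
      split_ifs with hk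
      · rw [fiberMap_id]
        rfl
      -- The scalar `0` serves to show that the zero morphism induces zero on fibers.
      · have := fiberMap_smul κ (0 : κ) (0 : E ⟶ E) x
        rw [zero_smul, zero_smul] at this
        rw [this]
        rfl
    refine (Finset.sum_congr rfl fun k _ =>
      congrArg (TensorProduct.mk κ V (Fiber E x) (Module.finBasis κ V k)) (h k)).trans ?_
    rw [Finset.sum_eq_single j]
    · simp
    · intro k _ hk
      simp [Ne.symm hk]
    · simp
  have h2 : tensorFiber κ V E x ∘ₗ tensorFiberInv κ V E x = LinearMap.id := by
    rw [← fiberMap_id]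
    have h := congrArg (fun φ => fiberMap κ φ x) (tensorπ_tensorι_total κ V E)
    refine Eq.trans ?_ h
    simp only [fiberMap_sum, fiberMap_comp]
    ext y
    simp only [tensorFiberInv, LinearMap.sum_apply, LinearMap.comp_apply, map_sum]
    exact Finset.sum_congr rfl fun k _ => tensorFiber_basis_tmul κ V E x k
      (fiberMap κ (tensorπ κ V E k) x y)
  exact ⟨Function.LeftInverse.injective (LinearMap.congr_fun h1),
    Function.RightInverse.surjective (LinearMap.congr_fun h2)⟩

end

variable {κ}

theorem tensorFiber_naturality {V W : Type u} [AddCommGroup V] [Module κ V] [FiniteDimensional κ V]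
    [AddCommGroup W] [Module κ W] [FiniteDimensional κ W] (A : V →ₗ[κ] W) {E F : X.Modules}
    (σ : E ⟶ F) (x : X) :
    tensorFiber κ W F x ∘ₗ TensorProduct.map A (fiberMap κ σ x) =
      fiberMap κ (tensorMap A σ) x ∘ₗ tensorFiber κ V E x := by
  refine TensorProduct.ext ((Module.finBasis κ V).ext fun j => LinearMap.ext fun y => ?_)
  change tensorFiber κ W F x (A (Module.finBasis κ V j) ⊗ₜ fiberMap κ σ x y) =
    fiberMap κ (tensorMap A σ) x (tensorFiber κ V E x (Module.finBasis κ V j ⊗ₜ y))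
  rw [tensorFiber_basis_tmul, tensorFiber_tmul]
  have h := congrArg (fun φ => fiberMap κ φ x y) (tensorι_tensorMap A σ j)
  simp only [fiberMap_sum, fiberMap_comp, fiberMap_smul, LinearMap.sum_apply, LinearMap.smul_apply,
    LinearMap.comp_apply, LinearMap.toMatrix_apply] at h
  exact h.symm

variable {w : ℕ} {E F : X.Modules}

/-- The comparison maps `tensorFiber` are bijective and natural, so they identify the map defining
global injectivity with the fiber at `x` of the sheaf map. -/
theorem injective_iff_fiberLin_injective (σ : Fin w → (E ⟶ F)) (R : KroneckerRep κ w) (x : X) :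
    Function.Injective (∑ i, TensorProduct.map (R.A i) (fiberMap κ (σ i) x)) ↔
      Function.Injective (fiberLin (repMap σ R) x) := by
  have h : tensorFiber κ R.W F x ∘ₗ (∑ i, TensorProduct.map (R.A i) (fiberMap κ (σ i) x)) =
      fiberMap κ (repMap σ R) x ∘ₗ tensorFiber κ R.V E x := by
    rw [repMap, fiberMap_sum]
    refine TensorProduct.ext' fun v y => ?_
    have h' := fun i => LinearMap.congr_fun (tensorFiber_naturality (R.A i) (σ i) x) (v ⊗ₜ y)
    simp only [LinearMap.comp_apply] at h'
    simp only [LinearMap.comp_apply, LinearMap.sum_apply, map_sum, h']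
  -- Here the sum is a sum of functions, as in the goal, whereas in `h` it is a sum of linear maps.
  have h' : tensorFiber κ R.W F x ∘
      (∑ i, TensorProduct.map (R.A i) (fiberMap κ (σ i) x)) =
      fiberLin (repMap σ R) x ∘ tensorFiber κ R.V E x := by
    funext y
    have := LinearMap.congr_fun h y
    rw [LinearMap.comp_apply, LinearMap.sum_apply] at this
    rw [Function.comp_apply, Finset.sum_apply]
    exact this
  rw [← (tensorFiber_bijective κ R.W F x).1.of_comp_iff, h',
    Function.Injective.of_comp_iff' _ (tensorFiber_bijective κ R.V E x)]

end FibersOfTensor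

/-! ### Sheaf maps as tuples of scalar matrices. -/

section Matrices

variable {κ : Type u} [Field κ] {X : Scheme.{u}} [X.Over (Spec (.of κ))] {E F : X.Modules}
  {ι : Type*} [Fintype ι]
  {V W : Type u} [AddCommGroup V] [Module κ V] [FiniteDimensional κ V]
  [AddCommGroup W] [Module κ W] [FiniteDimensional κ W]

theorem tensorι_sum_tensorMap_tensorπ (σ : ι → (E ⟶ F)) (A : ι → V →ₗ[κ] W)
    (j : Fin (Module.finrank κ V)) (k : Fin (Module.finrank κ W)) :
    tensorι κ V E j ≫ (∑ i, tensorMap (A i) (σ i)) ≫ tensorπ κ W F k =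
      ∑ i, LinearMap.toMatrix (Module.finBasis κ V) (Module.finBasis κ W) (A i) k j • σ i := by
  simp only [Preadditive.sum_comp, Preadditive.comp_sum, tensorι_tensorMap_tensorπ]

/-- The `(k, j)` entry of `A i` is the `i`-th coordinate in `σ` of the `(j, k)` component of the
sheaf map, so the map determines every `A i`. -/
theorem sum_tensorMap_injective (σ : Module.Basis ι κ (E ⟶ F)) {A B : ι → V →ₗ[κ] W}
    (h : ∑ i, tensorMap (A i) (σ i) = ∑ i, tensorMap (B i) (σ i)) : A = B := by
  funext i
  refine (LinearMap.toMatrix (Module.finBasis κ V) (Module.finBasis κ W)).injective ?_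
  ext k j
  have h' := congrArg (fun φ => σ.repr (tensorι κ V E j ≫ φ ≫ tensorπ κ W F k) i) h
  simpa only [tensorι_sum_tensorMap_tensorπ, σ.repr_sum_self] using h'

theorem exists_sum_tensorMap_eq (σ : Module.Basis ι κ (E ⟶ F))
    (α : tensorObj κ V E ⟶ tensorObj κ W F) :
    ∃ A : ι → V →ₗ[κ] W, ∑ i, tensorMap (A i) (σ i) = α := by
  refine ⟨fun i => Matrix.toLin (Module.finBasis κ V) (Module.finBasis κ W) (Matrix.of fun k j =>
    σ.repr (tensorι κ V E j ≫ α ≫ tensorπ κ W F k) i), tensorObj_hom_ext fun j k => ?_⟩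
  rw [tensorι_sum_tensorMap_tensorπ]
  simp only [LinearMap.toMatrix_toLin, Matrix.of_apply, σ.sum_repr]

/-- The endomorphisms of a simple bundle have the basis `1`. -/
theorem IsSimpleBundle.exists_basis (hE : IsSimpleBundle κ E) :
    ∃ b : Module.Basis Unit κ (E ⟶ E), b () = 𝟙 E := by
  refine ⟨(Module.Basis.singleton Unit κ).map
    (LinearEquiv.ofBijective (LinearMap.toSpanSingleton κ (E ⟶ E) (𝟙 E)) hE), ?_⟩
  rw [Module.Basis.map_apply, Module.Basis.singleton_apply]
  exact one_smul κ (𝟙 E)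

theorem IsSimpleBundle.tensorMap_injective (hE : IsSimpleBundle κ E) {A B : V →ₗ[κ] W}
    (h : tensorMap A (𝟙 E) = tensorMap B (𝟙 E)) : A = B := by
  obtain ⟨b, hb⟩ := hE.exists_basis
  refine congrFun (sum_tensorMap_injective b (A := fun _ => A) (B := fun _ => B) ?_) ()
  simpa [hb] using h

/-- For simple `E` the endomorphisms have the one-element basis `𝟙 E`, so the sum over arrows has a
single term. -/
theorem IsSimpleBundle.exists_tensorMap_eq (hE : IsSimpleBundle κ E)
    (α : tensorObj κ V E ⟶ tensorObj κ W E) : ∃ A : V →ₗ[κ] W, tensorMap A (𝟙 E) = α := by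
  obtain ⟨b, hb⟩ := hE.exists_basis
  obtain ⟨A, hA⟩ := exists_sum_tensorMap_eq b α
  exact ⟨A (), by simpa [hb] using hA⟩

end Matrices

/-! ### Consequences of the vanishing of `Ext¹(F, E)` and `Hom(F, E)`. -/

section Lifting

variable {κ : Type u} [Field κ] {X : Scheme.{u}} {E F M N : X.Modules}
  {V W : Type u} [AddCommGroup V] [Module κ V] [AddCommGroup W] [Module κ W]

/-- By the long exact sequence the obstruction to lifting `ψ` lies in `Ext¹(F, V ⊗ E)`, a finite
product of copies of `Ext¹(F, E) = 0`. -/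
theorem exists_lift_of_ext1Vanishes (hExt : Ext1Vanishes F E) {f : tensorObj κ V E ⟶ M} {g : M ⟶ N}
    {z : f ≫ g = 0} (hS : (ShortComplex.mk f g z).ShortExact) (ψ : F ⟶ N) :
    ∃ φ : F ⟶ M, φ ≫ g = ψ := by
  let : HasExt.{u + 1} X.Modules := HasExt.standard X.Modules
  have hExt' : Subsingleton (Abelian.Ext F E 1) := hExt
  have h1 : Subsingleton (Abelian.Ext F (tensorObj κ V E) 1) :=
    (Abelian.Ext.addEquivBiproduct F
      (biproduct.isBilimit fun _ : Fin (Module.finrank κ V) => E) 1).toEquiv.subsingleton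
  obtain ⟨y, hy⟩ := Abelian.Ext.covariant_sequence_exact₃ F hS (Abelian.Ext.mk₀ ψ) (zero_add 1)
    (h1.elim _ _)
  obtain ⟨φ, rfl⟩ := (Abelian.Ext.mk₀_bijective F M).2 y
  refine ⟨φ, (Abelian.Ext.mk₀_bijective F N).1 ?_⟩
  rw [← hy, Abelian.Ext.mk₀_comp_mk₀]

theorem exists_lift_tensorObj (hExt : Ext1Vanishes F E) {f : tensorObj κ V E ⟶ M} {g : M ⟶ N}
    {z : f ≫ g = 0} (hS : (ShortComplex.mk f g z).ShortExact) (ψ : tensorObj κ W F ⟶ N) :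
    ∃ φ : tensorObj κ W F ⟶ M, φ ≫ g = ψ := by
  choose φ hφ using fun j => exists_lift_of_ext1Vanishes hExt hS (tensorι κ W F j ≫ ψ)
  let φ' : tensorObj κ W F ⟶ M := biproduct.desc φ
  have hφ' : ∀ j, tensorι κ W F j ≫ φ' = φ j := biproduct.ι_desc φ
  refine ⟨φ', power_hom_ext' fun j => ?_⟩
  change tensorι κ W F j ≫ φ' ≫ g = tensorι κ W F j ≫ ψ
  rw [← hφ j, ← hφ' j, Category.assoc]

theorem tensorObj_hom_eq_zero (hHom : Subsingleton (F ⟶ E))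
    (φ : tensorObj κ W F ⟶ tensorObj κ V E) : φ = 0 :=
  tensorObj_hom_ext fun _ _ => Subsingleton.elim _ _

theorem IsVectorBundle.tensorObj (hE : IsVectorBundle E) (V : Type u) [AddCommGroup V]
    [Module κ V] : IsVectorBundle (tensorObj κ V E) :=
  hE.pow _

end Lifting

/-! ### The cokernel functor: faithful, full, essentially surjective. -/

section Equivalence

variable {κ : Type u} [Field κ] {X : Scheme.{u}} [X.Over (Spec (.of κ))] {E F : X.Modules} {w : ℕ}

/-- The projection onto the cokernel attached to a representation. -/
def repπ (σ : Fin w → (E ⟶ F)) (R : KroneckerRep κ w) :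
    tensorObj κ R.W F ⟶ (cokernelFunctor σ).obj R :=
  cokernel.π (repMap σ R)

instance (σ : Fin w → (E ⟶ F)) (R : KroneckerRep κ w) : Epi (repπ σ R) :=
  inferInstanceAs (Epi (cokernel.π (repMap σ R)))

theorem repMap_repπ (σ : Fin w → (E ⟶ F)) (R : KroneckerRep κ w) : repMap σ R ≫ repπ σ R = 0 :=
  cokernel.condition _

theorem shortExact_rep (σ : Fin w → (E ⟶ F)) (R : KroneckerRep κ w) (hR : Mono (repMap σ R)) :
    (ShortComplex.mk (repMap σ R) (repπ σ R) (repMap_repπ σ R)).ShortExact where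
  exact := ShortComplex.exact_cokernel (repMap σ R)

theorem repπ_map (σ : Fin w → (E ⟶ F)) {R S : KroneckerRep κ w} (f : R ⟶ S) :
    repπ σ R ≫ (cokernelFunctor σ).map f = tensorMap f.f₂ (𝟙 F) ≫ repπ σ S :=
  cokernel.π_desc _ _ _

theorem cokernelFunctor_map_injective (hE : IsSimpleBundle κ E) (hF : IsSimpleBundle κ F)
    (hHom : Subsingleton (F ⟶ E)) (σ : Fin w → (E ⟶ F)) {R S : KroneckerRep κ w}
    (hm : Mono (repMap σ S)) {f g : R ⟶ S}
    (h : (cokernelFunctor σ).map f = (cokernelFunctor σ).map g) : f = g := by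
  have hS := shortExact_rep σ S hm
  have h0 : (tensorMap f.f₂ (𝟙 F) - tensorMap g.f₂ (𝟙 F)) ≫ repπ σ S = 0 := by
    rw [Preadditive.sub_comp, ← repπ_map, ← repπ_map, h, sub_self]
  -- The difference is killed by the projection, so it factors through `S.V ⊗ E`; a map from a power
  -- of `F` to a power of `E` is zero.
  have h2 : tensorMap f.f₂ (𝟙 F) = tensorMap g.f₂ (𝟙 F) := by
    have h3 := hS.exact.lift_f _ h0
    rw [tensorObj_hom_eq_zero hHom (hS.exact.lift _ h0), zero_comp] at h3
    exact sub_eq_zero.1 h3.symm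
  have h3 : tensorMap f.f₁ (𝟙 E) = tensorMap g.f₁ (𝟙 E) := by
    rw [← cancel_mono (repMap σ S), ← repMap_naturality, ← repMap_naturality, h2]
  exact KroneckerRep.Hom.ext (hE.tensorMap_injective h3) (hF.tensorMap_injective h2)

theorem cokernelFunctor_map_surjective (hE : IsSimpleBundle κ E) (hF : IsSimpleBundle κ F)
    (hExt : Ext1Vanishes F E) (σ : Module.Basis (Fin w) κ (E ⟶ F)) {R S : KroneckerRep κ w}
    (hm : Mono (repMap σ S)) (φ : (cokernelFunctor σ).obj R ⟶ (cokernelFunctor σ).obj S) :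
    ∃ f : R ⟶ S, (cokernelFunctor σ).map f = φ := by
  have hS := shortExact_rep σ S hm
  -- Lift `φ` to the `F`-terms, giving `f₂`; the lift then maps the image of `repMap σ R` into the
  -- kernel of `repπ σ S`, giving `f₁`.
  obtain ⟨β, hβ⟩ := exists_lift_tensorObj hExt hS (repπ σ R ≫ φ)
  obtain ⟨f₂, rfl⟩ := hF.exists_tensorMap_eq β
  have h0 : (repMap σ R ≫ tensorMap f₂ (𝟙 F)) ≫ repπ σ S = 0 := by
    rw [Category.assoc, hβ, ← Category.assoc, repMap_repπ, zero_comp]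
  obtain ⟨f₁, hf₁⟩ := hE.exists_tensorMap_eq (hS.exact.lift _ h0)
  have h2 : tensorMap f₁ (𝟙 E) ≫ repMap σ S = repMap σ R ≫ tensorMap f₂ (𝟙 F) := by
    rw [hf₁]
    exact hS.exact.lift_f _ h0
  simp only [repMap, Preadditive.sum_comp, Preadditive.comp_sum, tensorMap_comp,
    Category.comp_id, Category.id_comp] at h2
  -- The commuting square of sheaf maps is a single equation; comparing coefficients in the basis
  -- `σ` splits it into one equation per arrow.
  have h3 := sum_tensorMap_injective σ h2
  refine ⟨⟨f₁, f₂, fun i => (congrFun h3 i).symm⟩, ?_⟩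
  rw [← cancel_epi (repπ σ R), repπ_map]
  exact hβ

/-- Allows `a` to be replaced by `Module.finrank κ V`, after which `power E a` is `tensorObj κ V E`
by definition. -/
theorem exists_vectorSpace (κ : Type u) [Field κ] (a : ℕ) :
    ∃ (V : Type u) (_ : AddCommGroup V) (_ : Module κ V) (_ : FiniteDimensional κ V),
      Module.finrank κ V = a :=
  ⟨Fin a → κ, inferInstance, inferInstance, inferInstance, by simp⟩

/-- A bundle with a resolution is the cokernel bundle of a representation. -/
theorem exists_rep_of_hasResolution (hE : IsVectorBundle E) (σ : Module.Basis (Fin w) κ (E ⟶ F))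
    {a b : ℕ} {C : X.Modules} (hC : IsVectorBundle C) (h : HasResolution E F a b C) :
    ∃ R : KroneckerRep κ w, IsGloballyInjective σ R ∧ Module.finrank κ R.V = a ∧
      Module.finrank κ R.W = b ∧ Nonempty ((cokernelFunctor σ).obj R ≅ C) := by
  obtain ⟨V, _, _, _, rfl⟩ := exists_vectorSpace κ a
  obtain ⟨W, _, _, _, rfl⟩ := exists_vectorSpace κ b
  obtain ⟨α, π, hz, hS⟩ := h
  obtain ⟨A, hA⟩ := exists_sum_tensorMap_eq (V := V) (W := W) σ α
  let R : KroneckerRep κ w := ⟨V, W, A⟩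
  have hR : repMap σ R = α := hA
  refine ⟨R, fun x _ => ?_, rfl, rfl, ⟨?_⟩⟩
  · rw [injective_iff_fiberLin_injective, hR]
    exact fiberLin_injective_of_shortExact hS (hE.pow _) hC x
  · have := hS.epi_g
    -- Both objects are cokernels of `α`, the second by exactness of the given resolution.
    exact cokernelIsoOfEq hR ≪≫
      (cokernelIsCokernel α).coconePointUniqueUpToIso hS.gIsCokernel

theorem mono_repMap [JacobsonSpace X] (hE : IsVectorBundle E) (hF : IsVectorBundle F)
    (σ : Fin w → (E ⟶ F)) {R : KroneckerRep κ w} (hR : IsGloballyInjective σ R) :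
    Mono (repMap σ R) ∧ IsVectorBundle ((cokernelFunctor σ).obj R) :=
  mono_and_isVectorBundle_cokernel (hE.tensorObj R.V) (hF.tensorObj R.W) _
    fun x hx => (injective_iff_fiberLin_injective σ R x).1 (hR x hx)

theorem hasResolution_cokernelFunctor (σ : Fin w → (E ⟶ F)) (R : KroneckerRep κ w)
    (hR : Mono (repMap σ R)) : HasResolution E F (Module.finrank κ R.V) (Module.finrank κ R.W)
      ((cokernelFunctor σ).obj R) :=
  ⟨repMap σ R, repπ σ R, repMap_repπ σ R, shortExact_rep σ R hR⟩

/-- The cokernel functor restricts to an equivalence between full subcategories which correspond to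
each other. -/
theorem isEquivalence_lift_cokernelFunctor [JacobsonSpace X] (hE : IsVectorBundle E)
    (hF : IsVectorBundle F) (hEs : IsSimpleBundle κ E) (hFs : IsSimpleBundle κ F)
    (hHom : Subsingleton (F ⟶ E)) (hExt : Ext1Vanishes F E)
    (σ : Module.Basis (Fin w) κ (E ⟶ F)) {P : ObjectProperty (KroneckerRep κ w)}
    {Q : ObjectProperty X.Modules} (hP : ∀ R, P R → IsGloballyInjective σ R)
    (h : ∀ R : P.FullSubcategory, Q ((P.ι ⋙ cokernelFunctor σ).obj R))
    (hQ : ∀ C, Q C → ∃ R, P R ∧ Nonempty ((cokernelFunctor σ).obj R ≅ C)) :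
    (Q.lift (P.ι ⋙ cokernelFunctor σ) h).IsEquivalence := by
  have hm : ∀ R : P.FullSubcategory, Mono (repMap σ R.obj) := fun R =>
    (mono_repMap hE hF σ (hP _ R.property)).1
  have hfaith : (P.ι ⋙ cokernelFunctor σ).Faithful :=
    { map_injective := fun {R S} f g hfg => by
        exact P.ι.map_injective (cokernelFunctor_map_injective hEs hFs hHom σ (hm S) hfg) }
  have hfull : (P.ι ⋙ cokernelFunctor σ).Full :=
    { map_surjective := fun {R S} φ => by
        obtain ⟨f, hf⟩ := cokernelFunctor_map_surjective hEs hFs hExt σ (hm S) φ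
        obtain ⟨g, rfl⟩ := P.ι.map_surjective f
        exact ⟨g, hf⟩ }
  exact
    { essSurj := ⟨fun C => by
        obtain ⟨R, hR, ⟨e⟩⟩ := hQ C.obj C.property
        exact ⟨⟨R, hR⟩, ⟨Q.fullyFaithfulι.preimageIso e⟩⟩⟩ }

end Equivalence

end

end KroneckerCokernel

/-! ### The two equivalences. -/

theorem theorem3p5 {κ : Type u} [Field κ] [IsAlgClosed κ] [CharZero κ]
    (X : Scheme.{u}) [X.Over (Spec (.of κ))] [IsIntegral X] [Smooth (X ↘ Spec (.of κ))]
    (hX : IsProjective κ X) (n : ℕ) (hn : 2 ≤ n) (hdim : topologicalKrullDim X = n)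
    (E F : X.Modules) (e f : ℕ)
    (hE : IsLocallyFreeOfRank E e) (hF : IsLocallyFreeOfRank F f)
    (hEsimple : IsSimpleBundle κ E) (hFsimple : IsSimpleBundle κ F)
    (hHom : Subsingleton (F ⟶ E)) (hExt : Ext1Vanishes F E)
    (hgg : IsGloballyGenerated (dualTensor E F))
    (w : ℕ) (hw : 3 ≤ w) (σ : Module.Basis (Fin w) κ (E ⟶ F)) :
    (∃ h : ∀ R : (IsGloballyInjective (κ := κ) σ).FullSubcategory,
        IsCokernelBundle E F (((IsGloballyInjective (κ := κ) σ).ι ⋙ cokernelFunctor σ).obj R),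
      ((IsCokernelBundle E F).lift
        ((IsGloballyInjective (κ := κ) σ).ι ⋙ cokernelFunctor σ) h).IsEquivalence) ∧
    (∃ h : ∀ R : (IsGloballyInjectiveOfRankGE (κ := κ) e f n σ).FullSubcategory,
        IsCokernelBundleOfRankGE e f n E F
          (((IsGloballyInjectiveOfRankGE (κ := κ) e f n σ).ι ⋙ cokernelFunctor σ).obj R),
      ((IsCokernelBundleOfRankGE e f n E F).lift
        ((IsGloballyInjectiveOfRankGE (κ := κ) e f n σ).ι ⋙ cokernelFunctor σ) h).IsEquivalence) := by
  -- A scheme locally of finite type over a field is Jacobson, which makes closed points sufficient.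
  have hJ : JacobsonSpace X := LocallyOfFiniteType.jacobsonSpace (X ↘ Spec (.of κ))
  have hE' := hE.isVectorBundle
  have hF' := hF.isVectorBundle
  refine ⟨⟨fun R => ?_, ?_⟩, ⟨fun R => ?_, ?_⟩⟩
  · obtain ⟨hm, hv⟩ := mono_repMap hE' hF' σ R.property
    exact ⟨hv, _, _, hasResolution_cokernelFunctor σ R.obj hm⟩
  · refine isEquivalence_lift_cokernelFunctor hE' hF' hEsimple hFsimple hHom hExt σ
      (fun _ h => h) _ ?_
    rintro C ⟨hC, a, b, h⟩
    obtain ⟨R, hR, -, -, hiso⟩ := exists_rep_of_hasResolution hE' σ hC h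
    exact ⟨R, hR, hiso⟩
  · obtain ⟨hm, hv⟩ := mono_repMap hE' hF' σ R.property.1
    exact ⟨hv, _, _, R.property.2, hasResolution_cokernelFunctor σ R.obj hm⟩
  · refine isEquivalence_lift_cokernelFunctor hE' hF' hEsimple hFsimple hHom hExt σ
      (fun _ h => h.1) _ ?_
    rintro C ⟨hC, a, b, hab, h⟩
    -- Substituting the dimensions of `R` for `a` and `b` turns the bound `hab` on the resolution
    -- into the bound on `R`.
    obtain ⟨R, hR, rfl, rfl, hiso⟩ := exists_rep_of_hasResolution hE' σ hC h
    exact ⟨R, ⟨hR, hab⟩, hiso⟩
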